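/- Let $n\ge 2$ and consider $n$ qubits on a line, with stabilizer generators $K_1=X_1Z_2$, $K_i=Z_{i-1}X_iZ_{i+1}$ ($1<i<n$), $K_n=Z_{n-1}X_n$; let $|C_n\rangle$ be the linear cluster state, i.e. $|+\rangle^{\otimes n}$ followed by controlled-$Z$ gates between neighbouring qubits. For a two-qubit state $\tau$ shared by Alice and Bob, let $F_T(\tau)$ be its teleportation fidelity: Alice measures the input qubit and her half of $\tau$ in the Bell basis, Bob applies a unitary depending on her result, the fidelity of his output with the pure input state is averaged uniformly over the Bloch sphere, and the supremum is taken over Bob's choices of unitaries. Let $F(\tau)=\max_U\langle\phi^+|(1\otimes U)\tau(1\otimes U^\dagger)|\phi^+\rangle$ be the fully entangled fraction, where $|\phi^+\rangle=(|00\rangle+|11\rangle)/\sqrt2$. Then $F_T(\tau)=\frac13(1+2F(\tau))$ for every two-qubit state $\tau$. Fix for each of the qubits $2,\dots,n-1$ a measurement basis, $X$ or $Y$. For an $n$-qubit state $\rho$ let $p_s$ be the probability of the outcome string $s$ and $\rho_s$ the resulting state of qubits $1$ and $n$, and put $F_T(\rho)=\sum_s p_s F_T(\rho_s)$. For each such choice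 of bases the following holds. 1. If $c\in\mathbb R$ and $\rho$ is an $n$-qubit state with $\mathrm{Tr}(K_i\rho)\ge c$ for all $i$ (in particular if all these expectation values equal $c=\langle ZXZ\rangle$), then $$F_T(\rho)\ \ge\ 1-\frac n3(1-c).$$ 2. There is a choice of Bob's unitary corrections, depending only on $s$ and on Alice's Bell result (not on $\rho$ or $c$), for which the average teleportation fidelity already satisfies this bound for all $c$ and $\rho$ as in 1, and for which the bound is attained, for every outcome $s$, by the worst-case state $$\rho_n^{WC}=\lambda|C_n\rangle\langle C_n|+\frac{1-\lambda}{n}\sum_{i=1}^n Z_i|C_n\rangle\langle C_n|Z_i,\qquad \lambda=1-\frac n2(1-c),$$ for every $c\le 1$ with $n(1-c)\le 2$ (i.e. $0\le\lambda\le1$). 3. For every $c\le 1$ with $n(1-c)\le 2$, $\rho_n^{WC}$ is a state with $\mathrm{Tr}(K_i\rho_n^{WC})=c$ for all $i$, and each outcome $s$ has positive probability and leaves qubits $1$ and $n$ in a state of teleportation fidelity $F_T\ge 1-\frac n3(1-c)$. 4. The bound is tight: if moreover $n(1-c)\le 1$ (i.e. the bound is at least the classical value $2/3$), then for $\rho_n^{WC}$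 every outcome $s$ leaves a state with $F_T=1-\frac n3(1-c)$, and $F_T(\rho_n^{WC})=1-\frac n3(1-c)$. -/

import Mathlib

open scoped Kronecker ComplexOrder

noncomputable section

namespace LinearCluster

/-- Single-qubit operators, in the computational basis. -/
abbrev QubitOp := Matrix (Fin 2) (Fin 2) ℂ

/-- The Pauli operators `X`, `Y`, `Z`. -/
def pauliX : QubitOp := !![0, 1; 1, 0]

def pauliY : QubitOp := !![0, -Complex.I; Complex.I, 0]

def pauliZ : QubitOp := !![1, 0; 0, -1]

/-- Operators on `n` qubits; computational basis states are labelled by bit strings. -/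
abbrev Op (n : ℕ) := Matrix (Fin n → Fin 2) (Fin n → Fin 2) ℂ

/-- Operators on a pair of qubits (Alice's qubit, Bob's qubit). -/
abbrev PairOp := Matrix (Fin 2 × Fin 2) (Fin 2 × Fin 2) ℂ

/-- Quantum states: positive semidefinite matrices of trace one. -/
def IsState {ι : Type} [Fintype ι] (ρ : Matrix ι ι ℂ) : Prop :=
  ρ.PosSemidef ∧ ρ.trace = 1

/-- The expectation value `Tr (A ρ)` of a Hermitian operator `A`. -/
def expect {ι : Type} [Fintype ι] (A ρ : Matrix ι ι ℂ) : ℝ := (A * ρ).trace.re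

/-- The number `⟨v| M |v⟩`, for Hermitian `M`. -/
def sandwich {ι : Type} [Fintype ι] (v : ι → ℂ) (M : Matrix ι ι ℂ) : ℝ :=
  (star v ⬝ᵥ (M.mulVec v)).re

/-- The tensor product `A₁ ⊗ ⋯ ⊗ Aₙ` of single-qubit operators. -/
def tensor {n : ℕ} (A : Fin n → QubitOp) : Op n :=
  Matrix.of fun x y => ∏ i, A i (x i) (y i)

/-! ### The linear cluster state and its stabilizer generators -/

/-- The stabilizer generator `K i` of the linear cluster state: `X` on qubit `i` and `Z` on its
neighbours on the line. In the bulk this is `Z X Z`; at the two ends it is `X Z` and `Z X`. -/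
def gen {n : ℕ} (i : Fin n) : Op n :=
  tensor fun j =>
    if j = i then pauliX
    else if (j : ℕ) + 1 = (i : ℕ) ∨ (i : ℕ) + 1 = (j : ℕ) then pauliZ
    else 1

/-- `Z` on qubit `i`. -/
def opZ {n : ℕ} (i : Fin n) : Op n :=
  tensor fun j => if j = i then pauliZ else 1

/-- The linear cluster state: all qubits in `|+⟩`, followed by controlled-`Z` gates between
neighbours. -/
def clusterVec (n : ℕ) (x : Fin n → Fin 2) : ℂ :=
  ((1 / Real.sqrt 2 : ℝ) : ℂ) ^ n *
    ∏ i : Fin n, ∏ j : Fin n,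
      if (i : ℕ) + 1 = (j : ℕ) ∧ x i = 1 ∧ x j = 1 then (-1 : ℂ) else 1

/-- The projector onto the linear cluster state. -/
def clusterProj (n : ℕ) : Op n :=
  Matrix.vecMulVec (clusterVec n) (star (clusterVec n))

/-- The weight of the ideal cluster state in the worst-case state. -/
def wcWeight (n : ℕ) (c : ℝ) : ℝ := 1 - n * (1 - c) / 2

/-- The worst-case state on `n` qubits with generator expectation value `c`. -/
def wcState (n : ℕ) (c : ℝ) : Op n :=
  (wcWeight n c : ℂ) • clusterProj n +
    (((1 - wcWeight n c) / n : ℝ) : ℂ) • ∑ i : Fin n, opZ i * clusterProj n * opZ i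

/-! ### Measuring the inner qubits of a line of `k + 2` qubits -/

/-- The two bases in which an inner qubit may be measured. -/
inductive MeasBasis : Type
  | X
  | Y

/-- The observable that belongs to a basis. -/
def MeasBasis.obs : MeasBasis → QubitOp
  | .X => pauliX
  | .Y => pauliY

/-- The projector onto outcome `(-1) ^ s` of a single-qubit measurement. -/
def outcomeProj (b : MeasBasis) (s : Fin 2) : QubitOp :=
  (1 / 2 : ℂ) • (1 + (-1 : ℂ) ^ (s : ℕ) • b.obs)

/-- The family `(a, z₁, …, z_k, b)` with `k + 2` members. -/
def frame {α : Type} {k : ℕ} (a : α) (z : Fin k → α) (b : α) : Fin (k + 2) → α :=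
  Fin.cons (α := fun _ => α) a (Fin.snoc (α := fun _ => α) z b)

/-- The projector `1 ⊗ P₁ ⊗ ⋯ ⊗ P_k ⊗ 1` for the outcome string `s` of the measurements `m` on the
`k` inner qubits. -/
def measProj {k : ℕ} (m : Fin k → MeasBasis) (s : Fin k → Fin 2) : Op (k + 2) :=
  tensor (frame 1 (fun i => outcomeProj (m i) (s i)) 1)

/-- The partial trace over the inner qubits; the first and the last qubit are kept. -/
def traceInner {k : ℕ} (ρ : Op (k + 2)) : PairOp :=
  Matrix.of fun p q => ∑ z : Fin k → Fin 2, ρ (frame p.1 z p.2) (frame q.1 z q.2)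

/-- The probability of the outcome string `s`. -/
def outcomeProb {k : ℕ} (m : Fin k → MeasBasis) (ρ : Op (k + 2)) (s : Fin k → Fin 2) : ℝ :=
  expect (measProj m s) ρ

/-- The state of the first and the last qubit after the measurements `m` with outcomes `s`
(meaningful when the outcome has nonzero probability). -/
def postState {k : ℕ} (m : Fin k → MeasBasis) (ρ : Op (k + 2)) (s : Fin k → Fin 2) : PairOp :=
  ((outcomeProb m ρ s : ℂ))⁻¹ • traceInner (measProj m s * ρ * measProj m s)

/-! ### Teleportation through a pair of qubits -/

/-- The Bell vectors `(σⱼ ⊗ 1)|φ⁺⟩` with `σ₀, …, σ₃ = 1, X, Y, Z`; index `0` is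
`|φ⁺⟩ = (|00⟩ + |11⟩) / √2` itself. -/
def bellVec (j : Fin 4) (p : Fin 2 × Fin 2) : ℂ :=
  ((1 / Real.sqrt 2 : ℝ) : ℂ) * (![1, pauliX, pauliY, pauliZ] j : QubitOp) p.1 p.2

/-- `⟨φ⁺| (1 ⊗ U) τ (1 ⊗ U†) |φ⁺⟩`. -/
def bellOverlap (τ : PairOp) (U : Matrix.unitaryGroup (Fin 2) ℂ) : ℝ :=
  sandwich (bellVec 0)
    (((1 : QubitOp) ⊗ₖ (U : QubitOp)) * τ * ((1 : QubitOp) ⊗ₖ (U : QubitOp).conjTranspose))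

/-- The fully entangled fraction. -/
def fullyEntangledFraction (τ : PairOp) : ℝ :=
  ⨆ U : Matrix.unitaryGroup (Fin 2) ℂ, bellOverlap τ U

/-- Bob's unnormalized state `⟨Φⱼ| (|ψ⟩⟨ψ| ⊗ τ) |Φⱼ⟩` after Alice has found the Bell vector `Φⱼ` in a
measurement of the input qubit, in state `ψ`, together with her half of `τ`. Its trace is the
probability of that outcome. -/
def bobState (τ : PairOp) (ψ : Fin 2 → ℂ) (j : Fin 4) : QubitOp :=
  Matrix.of fun b b' => ∑ c : Fin 2, ∑ a : Fin 2, ∑ c' : Fin 2, ∑ a' : Fin 2,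
    star (bellVec j (c, a)) * (ψ c * star (ψ c') * τ (a, b) (a', b')) * bellVec j (c', a')

/-- The fidelity with which the pure state `ψ` is teleported through `τ` if Bob applies the unitary
`V j` on learning Alice's result `j`. -/
def inputFidelity (τ : PairOp) (V : Fin 4 → Matrix.unitaryGroup (Fin 2) ℂ) (ψ : Fin 2 → ℂ) : ℝ :=
  ∑ j : Fin 4, sandwich ψ ((V j : QubitOp) * bobState τ ψ j * (V j : QubitOp).conjTranspose)

/-- The pure qubit state with polar angle `θ` and azimuth `φ` on the Bloch sphere. -/
def blochVec (θ φ : ℝ) : Fin 2 → ℂ :=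
  ![(Real.cos (θ / 2) : ℂ), Complex.exp (Complex.I * φ) * (Real.sin (θ / 2) : ℂ)]

/-- The fidelity of teleportation with Bob's corrections `V`, averaged over all pure inputs
(uniformly on the Bloch sphere). -/
def fidelityWith (τ : PairOp) (V : Fin 4 → Matrix.unitaryGroup (Fin 2) ℂ) : ℝ :=
  (1 / (4 * Real.pi)) *
    ∫ φ in (0 : ℝ)..(2 * Real.pi), ∫ θ in (0 : ℝ)..Real.pi,
      inputFidelity τ V (blochVec θ φ) * Real.sin θ

/-- The teleportation fidelity of `τ`: the average fidelity for the best choice of Bob's unitary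
corrections. -/
def teleportFidelity (τ : PairOp) : ℝ :=
  ⨆ V : Fin 4 → Matrix.unitaryGroup (Fin 2) ℂ, fidelityWith τ V

/-- The fidelity of teleportation between the first and the last qubit of `ρ`, after the inner
qubits have been measured in the bases `m`; the outcomes are known, and the result is averaged over
them. -/
def localizedFidelity {k : ℕ} (m : Fin k → MeasBasis) (ρ : Op (k + 2)) : ℝ :=
  ∑ s : Fin k → Fin 2, outcomeProb m ρ s * teleportFidelity (postState m ρ s)

/-- The same quantity for a fixed list of Bob's corrections: `V s j` is applied if the inner qubits
gave the outcomes `s` and Alice's Bell measurement gave `j`. -/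
def localizedFidelityWith {k : ℕ} (m : Fin k → MeasBasis)
    (V : (Fin k → Fin 2) → Fin 4 → Matrix.unitaryGroup (Fin 2) ℂ) (ρ : Op (k + 2)) : ℝ :=
  ∑ s : Fin k → Fin 2, outcomeProb m ρ s * fidelityWith (postState m ρ s) (V s)

end LinearCluster

end

/-! Teleportation formula: expanded in the input `ψ`, the fidelity has degree two in `ψ` and degree
two in its conjugate. Its Bloch average is one sixth of the sum of the two index contractions
(`bloch_average`). One contraction gives the trace of `τ`. For each Bell result `j`, the other gives
the overlap of `τ` with the maximally entangled state of `σⱼ†Vⱼ`. The corrections `Vⱼ = σⱼU` make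
the four overlaps equal to that of one arbitrary `U`, so optimizing the teleportation is the same as
optimizing the overlap.

Lower bound: the vectors `Z^w|Cₙ⟩` form an orthonormal basis that diagonalizes all generators, with
eigenvalue `(-1)^(w i)` for `Kᵢ`. Hence `∑ Kᵢ` is `n` on the cluster state and at most `n - 2` on
its complement, and `Tr (Kᵢρ) ≥ c` forces `⟨Cₙ|ρ|Cₙ⟩ ≥ 1 - n(1-c)/2` (`le_sandwich_clusterVec`).
Measuring the inner qubits of `Z^w|Cₙ⟩` leaves the outer pair in the state of a matrix product of
diagonal phases and Hadamards (`embed_conjTranspose_mulVec`). This product is unitary, so the pair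
is maximally entangled and every outcome has probability `2^(-k)`. If Bob undoes the unitary of the
ideal state, Cauchy–Schwarz over the outcomes shows that the localized overlap is on average at
least `⟨Cₙ|ρ|Cₙ⟩` (`sandwich_clusterVec_le`), and `(1 + 2F)/3` turns this into the bound.

Tightness: a single `Z` error inserts a traceless factor into the chain, so after measurement each
error state is still orthogonal to the ideal one (`trace_chain_conjTranspose_mul`). The fixed
corrections thus see exactly the weight `λ`. For `λ ≥ 1/2`, Bessel's inequality shows that no other
maximally entangled vector has a larger overlap (`sandwich_outerWcState_le`). -/

noncomputable section

namespace LinearCluster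

/-! ### Averages over the Bloch sphere -/

/-- The average over the unit sphere of a real polynomial of degree two. -/
theorem sphere_average (a x y z xx yy zz xy xz yz : ℝ) :
    (1 / (4 * Real.pi)) * ∫ φ in (0 : ℝ)..(2 * Real.pi), ∫ θ in (0 : ℝ)..Real.pi,
      (a + x * (Real.sin θ * Real.cos φ) + y * (Real.sin θ * Real.sin φ) + z * Real.cos θ
        + xx * (Real.sin θ * Real.cos φ) ^ 2 + yy * (Real.sin θ * Real.sin φ) ^ 2
        + zz * Real.cos θ ^ 2 + xy * ((Real.sin θ * Real.cos φ) * (Real.sin θ * Real.sin φ))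
        + xz * ((Real.sin θ * Real.cos φ) * Real.cos θ)
        + yz * ((Real.sin θ * Real.sin φ) * Real.cos θ)) * Real.sin θ =
    a + (xx + yy + zz) / 3 := by
  have inner : ∀ φ : ℝ, (∫ θ in (0 : ℝ)..Real.pi,
      (a + x * (Real.sin θ * Real.cos φ) + y * (Real.sin θ * Real.sin φ) + z * Real.cos θ
        + xx * (Real.sin θ * Real.cos φ) ^ 2 + yy * (Real.sin θ * Real.sin φ) ^ 2
        + zz * Real.cos θ ^ 2 + xy * ((Real.sin θ * Real.cos φ) * (Real.sin θ * Real.sin φ))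
        + xz * ((Real.sin θ * Real.cos φ) * Real.cos θ)
        + yz * ((Real.sin θ * Real.sin φ) * Real.cos θ)) * Real.sin θ) =
      (2 * a + 2 / 3 * zz) + (Real.pi / 2 * x) * Real.cos φ + (Real.pi / 2 * y) * Real.sin φ
        + (4 / 3 * xx) * Real.cos φ ^ 2 + (4 / 3 * yy) * Real.sin φ ^ 2
        + (4 / 3 * xy) * (Real.sin φ * Real.cos φ) := by
    intro φ
    -- An antiderivative in `θ`, with the terms grouped by their `θ`-dependence: `sin`, `sin²`, `sin
    -- cos`, `sin³`, `cos² sin`, `sin² cos`.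
    have hd : ∀ θ ∈ Set.uIcc (0 : ℝ) Real.pi, HasDerivAt (fun θ : ℝ =>
        -a * Real.cos θ + (x * Real.cos φ + y * Real.sin φ) * ((θ - Real.sin θ * Real.cos θ) / 2)
          + z * (Real.sin θ ^ 2 / 2)
          + (xx * Real.cos φ ^ 2 + yy * Real.sin φ ^ 2 + xy * Real.cos φ * Real.sin φ)
              * (-Real.cos θ + Real.cos θ ^ 3 / 3)
          - zz * (Real.cos θ ^ 3 / 3)
          + (xz * Real.cos φ + yz * Real.sin φ) * (Real.sin θ ^ 3 / 3))
        ((a + x * (Real.sin θ * Real.cos φ) + y * (Real.sin θ * Real.sin φ) + z * Real.cos θ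
        + xx * (Real.sin θ * Real.cos φ) ^ 2 + yy * (Real.sin θ * Real.sin φ) ^ 2
        + zz * Real.cos θ ^ 2 + xy * ((Real.sin θ * Real.cos φ) * (Real.sin θ * Real.sin φ))
        + xz * ((Real.sin θ * Real.cos φ) * Real.cos θ)
        + yz * ((Real.sin θ * Real.sin φ) * Real.cos θ)) * Real.sin θ) θ := by
      intro θ _
      have hs := Real.hasDerivAt_sin θ
      have hc := Real.hasDerivAt_cos θ
      have := (((((hc.const_mul (-a)).add
        ((((hasDerivAt_id θ).sub (hs.mul hc)).div_const 2).const_mul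
          (x * Real.cos φ + y * Real.sin φ))).add (((hs.pow 2).div_const 2).const_mul z)).add
        ((hc.neg.add ((hc.pow 3).div_const 3)).const_mul
          (xx * Real.cos φ ^ 2 + yy * Real.sin φ ^ 2 + xy * Real.cos φ * Real.sin φ))).sub
        (((hc.pow 3).div_const 3).const_mul zz)).add
        (((hs.pow 3).div_const 3).const_mul (xz * Real.cos φ + yz * Real.sin φ))
      refine HasDerivAt.congr_deriv this ?_
      norm_num
      linear_combination (-(x * Real.cos φ + y * Real.sin φ) / 2
        - (xx * Real.cos φ ^ 2 + yy * Real.sin φ ^ 2 + xy * Real.cos φ * Real.sin φ) * Real.sin θ)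
          * Real.cos_sq' θ
    rw [intervalIntegral.integral_eq_sub_of_hasDerivAt hd
      (Continuous.intervalIntegrable (by fun_prop) _ _)]
    simp
    ring
  simp_rw [inner]
  have hd : ∀ φ ∈ Set.uIcc (0 : ℝ) (2 * Real.pi), HasDerivAt (fun φ : ℝ =>
      (2 * a + 2 / 3 * zz) * φ + (Real.pi / 2 * x) * Real.sin φ - (Real.pi / 2 * y) * Real.cos φ
        + (4 / 3 * xx) * ((φ + Real.sin φ * Real.cos φ) / 2)
        + (4 / 3 * yy) * ((φ - Real.sin φ * Real.cos φ) / 2)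
        + (4 / 3 * xy) * (Real.sin φ ^ 2 / 2))
      ((2 * a + 2 / 3 * zz) + (Real.pi / 2 * x) * Real.cos φ + (Real.pi / 2 * y) * Real.sin φ
        + (4 / 3 * xx) * Real.cos φ ^ 2 + (4 / 3 * yy) * Real.sin φ ^ 2
        + (4 / 3 * xy) * (Real.sin φ * Real.cos φ)) φ := by
    intro φ _
    have hs := Real.hasDerivAt_sin φ
    have hc := Real.hasDerivAt_cos φ
    have := ((((((hasDerivAt_id φ).const_mul (2 * a + 2 / 3 * zz)).add
      (hs.const_mul (Real.pi / 2 * x))).sub (hc.const_mul (Real.pi / 2 * y))).add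
      ((((hasDerivAt_id φ).add (hs.mul hc)).div_const 2).const_mul (4 / 3 * xx))).add
      ((((hasDerivAt_id φ).sub (hs.mul hc)).div_const 2).const_mul (4 / 3 * yy))).add
      (((hs.pow 2).div_const 2).const_mul (4 / 3 * xy))
    refine HasDerivAt.congr_deriv this ?_
    norm_num
    linear_combination (- 2 / 3 * xx - 2 / 3 * yy) * Real.cos_sq' φ
  rw [intervalIntegral.integral_eq_sub_of_hasDerivAt hd
    (Continuous.intervalIntegrable (by fun_prop) _ _)]
  have := Real.pi_ne_zero
  simp
  field_simp
  ring

/-- The Bloch representation of a pure qubit state. -/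
theorem blochVec_mul_star (θ φ : ℝ) (q p : Fin 2) :
    blochVec θ φ q * star (blochVec θ φ p) = (1 / 2 : ℂ) *
      ((1 : QubitOp) q p + ((Real.sin θ * Real.cos φ : ℝ) : ℂ) * pauliX q p
        + ((Real.sin θ * Real.sin φ : ℝ) : ℂ) * pauliY q p
        + ((Real.cos θ : ℝ) : ℂ) * pauliZ q p) := by
  have hθ : θ = 2 * (θ / 2) := by ring
  have hs : Real.sin θ = 2 * Real.sin (θ / 2) * Real.cos (θ / 2) := by
    rw [← Real.sin_two_mul, ← hθ]
  have hc : Real.cos θ = 2 * Real.cos (θ / 2) ^ 2 - 1 := by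
    rw [← Real.cos_two_mul, ← hθ]
  have h1 := Real.sin_sq_add_cos_sq (θ / 2)
  have h2 := Real.sin_sq_add_cos_sq φ
  have he : Complex.exp (Complex.I * φ) = ⟨Real.cos φ, Real.sin φ⟩ := by
    rw [mul_comm, Complex.exp_mul_I]
    apply Complex.ext <;> simp [← Complex.ofReal_cos, ← Complex.ofReal_sin]
  rw [hs, hc]
  simp only [blochVec, he]
  generalize Real.sin (θ / 2) = s at *
  generalize Real.cos (θ / 2) = c at *
  generalize Real.sin φ = s' at *
  generalize Real.cos φ = c' at *
  fin_cases q <;> fin_cases p <;> apply Complex.ext <;>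
    simp [pauliX, pauliY, pauliZ, pow_two] <;> try ring_nf
  · linear_combination h1 + s ^ 2 * h2

/-- The average of a fourth-order polynomial `ψ_q ψ̄_p ψ_c ψ̄_c'` over the Bloch sphere. -/
theorem bloch_average (T : Fin 2 → Fin 2 → Fin 2 → Fin 2 → ℂ) :
    (1 / (4 * Real.pi)) * ∫ φ in (0 : ℝ)..(2 * Real.pi), ∫ θ in (0 : ℝ)..Real.pi,
      (∑ q, ∑ p, ∑ c, ∑ c', T q p c c' *
        ((blochVec θ φ q * star (blochVec θ φ p)) *
          (blochVec θ φ c * star (blochVec θ φ c')))).re * Real.sin θ =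
    ((∑ q, ∑ c, T q q c c) + ∑ q, ∑ c, T q c c q).re / 6 := by
  let σ : Fin 4 → QubitOp := ![1, pauliX, pauliY, pauliZ]
  -- Coefficients in the Pauli expansion of both projectors; the `4` collects the factor `1/2` of
  -- each Bloch representation.
  let g : Fin 4 → Fin 4 → ℝ := fun μ ν =>
    (∑ q, ∑ p, ∑ c, ∑ c', T q p c c' * (σ μ q p * σ ν c c')).re / 4
  have key : ∀ θ φ : ℝ, (∑ q, ∑ p, ∑ c, ∑ c', T q p c c' *
        ((blochVec θ φ q * star (blochVec θ φ p)) *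
          (blochVec θ φ c * star (blochVec θ φ c')))).re =
      (g 0 0 + (g 0 1 + g 1 0) * (Real.sin θ * Real.cos φ)
        + (g 0 2 + g 2 0) * (Real.sin θ * Real.sin φ) + (g 0 3 + g 3 0) * Real.cos θ
        + g 1 1 * (Real.sin θ * Real.cos φ) ^ 2 + g 2 2 * (Real.sin θ * Real.sin φ) ^ 2
        + g 3 3 * Real.cos θ ^ 2
        + (g 1 2 + g 2 1) * ((Real.sin θ * Real.cos φ) * (Real.sin θ * Real.sin φ))
        + (g 1 3 + g 3 1) * ((Real.sin θ * Real.cos φ) * Real.cos θ)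
        + (g 2 3 + g 3 2) * ((Real.sin θ * Real.sin φ) * Real.cos θ)) := by
    intro θ φ
    simp_rw [blochVec_mul_star]
    generalize Real.sin θ * Real.cos φ = x
    generalize Real.sin θ * Real.sin φ = y
    generalize Real.cos θ = z
    simp only [g, σ, Fin.sum_univ_two, pauliX, pauliY, pauliZ]
    simp
    ring
  simp_rw [key]
  -- Only `g 0 0` and a third of `g 1 1 + g 2 2 + g 3 3` survive. Since `X⊗X + Y⊗Y + Z⊗Z` is twice
  -- the swap minus the identity, this is the mean of the two contractions divided by three.
  rw [sphere_average]
  simp only [g, σ, Fin.sum_univ_two, pauliX, pauliY, pauliZ]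
  simp
  ring

/-! ### The teleportation fidelity in terms of overlaps with maximally entangled states -/

/-- The operators `1, X, Y, Z` as unitaries. -/
def pauliUnitary (j : Fin 4) : Matrix.unitaryGroup (Fin 2) ℂ :=
  ⟨![1, pauliX, pauliY, pauliZ] j, by
    rw [Matrix.mem_unitaryGroup_iff]
    fin_cases j <;> ext a b <;> fin_cases a <;> fin_cases b <;>
      simp [pauliX, pauliY, pauliZ, Matrix.mul_apply, Matrix.star_apply]⟩

theorem bellVec_eq (j : Fin 4) (c a : Fin 2) :
    bellVec j (c, a) = ((1 / Real.sqrt 2 : ℝ) : ℂ) * (pauliUnitary j : QubitOp) c a := rfl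

theorem inv_sqrt_two_mul_self :
    ((1 / Real.sqrt 2 : ℝ) : ℂ) * ((1 / Real.sqrt 2 : ℝ) : ℂ) = 1 / 2 := by
  rw [← Complex.ofReal_mul, div_mul_div_comm, Real.mul_self_sqrt (by norm_num)]
  norm_num

/-- Contraction with `φ⁺` identifies Alice's index with the row index of `U`; the `2` is the squared
normalization of `φ⁺`. -/
theorem bellOverlap_eq (τ : PairOp) (U : Matrix.unitaryGroup (Fin 2) ℂ) :
    bellOverlap τ U = (∑ b, ∑ b', ∑ a, ∑ a', (U : QubitOp) a b * star ((U : QubitOp) a' b') *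
      τ (a, b) (a', b')).re / 2 := by
  have h := inv_sqrt_two_mul_self
  have key : star (bellVec 0) ⬝ᵥ ((((1 : QubitOp) ⊗ₖ (U : QubitOp)) * τ *
      ((1 : QubitOp) ⊗ₖ (U : QubitOp).conjTranspose)).mulVec (bellVec 0)) =
      (((1 / Real.sqrt 2 : ℝ) : ℂ) * ((1 / Real.sqrt 2 : ℝ) : ℂ)) *
      ∑ b, ∑ b', ∑ a, ∑ a', (U : QubitOp) a b * star ((U : QubitOp) a' b') *
        τ (a, b) (a', b') := by
    generalize (U : QubitOp) = M
    simp only [dotProduct, Matrix.mulVec, Matrix.mul_apply, Fintype.sum_prod_type,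
      Fin.sum_univ_two, bellVec, Matrix.kroneckerMap_apply, Matrix.one_apply, Pi.star_apply,
      Matrix.conjTranspose_apply]
    simp
    ring
  rw [bellOverlap, sandwich, key, h]
  simp
  ring

/-- The coefficients of the fidelity as a polynomial in the input state. -/
def fidelityCoeff (τ : PairOp) (V B : QubitOp) (q p c c' : Fin 2) : ℂ :=
  ∑ b, ∑ b', ∑ a, ∑ a', V p b * star (V q b') * (star (B c a) * B c' a') * τ (a, b) (a', b')

/-- Puts the fidelity into the polynomial form that `bloch_average` integrates. -/
theorem sandwich_bobState (τ : PairOp) (V : QubitOp) (ψ : Fin 2 → ℂ) (j : Fin 4) :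
    sandwich ψ (V * bobState τ ψ j * V.conjTranspose) =
      (∑ q, ∑ p, ∑ c, ∑ c', fidelityCoeff τ V (Matrix.of fun c a => bellVec j (c, a)) q p c c' *
        ((ψ q * star (ψ p)) * (ψ c * star (ψ c')))).re := by
  rw [sandwich]
  congr 1
  simp only [fidelityCoeff, bobState, dotProduct, Matrix.mulVec, Matrix.mul_apply, Matrix.of_apply,
    Pi.star_apply, Matrix.conjTranspose_apply, Fin.sum_univ_two]
  ring

/-- In this contraction the correction and the Bell matrix are each paired with their own adjoint,
so unitarity removes both. -/
theorem sum_fidelityCoeff_trace (τ : PairOp) (V : Matrix.unitaryGroup (Fin 2) ℂ) (j : Fin 4) :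
    ∑ q, ∑ c, fidelityCoeff τ V (Matrix.of fun c a => bellVec j (c, a)) q q c c = τ.trace / 2 := by
  have hV : ∀ b b', ∑ q, (V : QubitOp) q b * star ((V : QubitOp) q b') = if b' = b then 1 else 0 := by
    intro b b'
    have := congrFun (congrFun (Matrix.UnitaryGroup.star_mul_self V) b') b
    rw [Matrix.mul_apply, Matrix.one_apply] at this
    rw [← this]
    exact Finset.sum_congr rfl fun q _ => by rw [Matrix.star_apply, mul_comm]
  have hB : ∀ a a', ∑ c, star (bellVec j (c, a)) * bellVec j (c, a') =
      if a = a' then 1 / 2 else 0 := by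
    intro a a'
    have := congrFun (congrFun (Matrix.UnitaryGroup.star_mul_self (pauliUnitary j)) a) a'
    rw [Matrix.mul_apply, Matrix.one_apply] at this
    have h2 : (if a = a' then 1 / 2 else 0 : ℂ) = 1 / 2 * if a = a' then 1 else 0 := by
      split_ifs <;> simp
    rw [h2, ← this, Finset.mul_sum]
    refine Finset.sum_congr rfl fun c _ => ?_
    rw [bellVec_eq, bellVec_eq, Matrix.star_apply, star_mul', ← inv_sqrt_two_mul_self]
    simp only [Complex.star_def, Complex.conj_ofReal]
    ring
  have key : ∑ q, ∑ c, fidelityCoeff τ V (Matrix.of fun c a => bellVec j (c, a)) q q c c =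
      ∑ b, ∑ b', ∑ a, ∑ a', (∑ q, (V : QubitOp) q b * star ((V : QubitOp) q b')) *
        (∑ c, star (bellVec j (c, a)) * bellVec j (c, a')) * τ (a, b) (a', b') := by
    simp only [fidelityCoeff, Matrix.of_apply, Fin.sum_univ_two]
    ring
  rw [key]
  simp_rw [hV, hB]
  simp [Fin.sum_univ_two, Matrix.trace, Fintype.sum_prod_type]
  ring

/-- In this contraction the output index of the correction is tied to the input index of the Bell
vector, which fuses the two matrices into `σⱼ†V`. -/
theorem sum_fidelityCoeff_overlap (τ : PairOp) (V : Matrix.unitaryGroup (Fin 2) ℂ) (j : Fin 4) :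
    (∑ q, ∑ c, fidelityCoeff τ V (Matrix.of fun c a => bellVec j (c, a)) q c c q).re =
      bellOverlap τ ((pauliUnitary j)⁻¹ * V) := by
  have hU : (((pauliUnitary j)⁻¹ * V : Matrix.unitaryGroup (Fin 2) ℂ) : QubitOp) =
      (pauliUnitary j : QubitOp).conjTranspose * (V : QubitOp) := rfl
  rw [bellOverlap_eq, hU]
  have key : ∑ q, ∑ c, fidelityCoeff τ V (Matrix.of fun c a => bellVec j (c, a)) q c c q =
      (((1 / Real.sqrt 2 : ℝ) : ℂ) * ((1 / Real.sqrt 2 : ℝ) : ℂ)) * ∑ b, ∑ b', ∑ a, ∑ a',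
        ((pauliUnitary j : QubitOp).conjTranspose * (V : QubitOp)) a b *
          star (((pauliUnitary j : QubitOp).conjTranspose * (V : QubitOp)) a' b') *
          τ (a, b) (a', b') := by
    simp only [fidelityCoeff, Matrix.of_apply, Fin.sum_univ_two, Matrix.mul_apply, bellVec_eq,
      Matrix.conjTranspose_apply, star_mul', star_add, Complex.star_def,
      Complex.conj_ofReal, Complex.conj_conj]
    ring
  rw [key, inv_sqrt_two_mul_self]
  simp only [Complex.mul_re]
  norm_num
  ring


/-- The average fidelity is the mean of `1 / 3` of the trace and the overlaps with the maximally
entangled states that belong to the corrections. -/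
theorem fidelityWith_eq (τ : PairOp) (V : Fin 4 → Matrix.unitaryGroup (Fin 2) ℂ) :
    fidelityWith τ V =
      τ.trace.re / 3 + (∑ j, bellOverlap τ ((pauliUnitary j)⁻¹ * V j)) / 6 := by
  have key : ∀ θ φ, inputFidelity τ V (blochVec θ φ) =
      (∑ q, ∑ p, ∑ c, ∑ c',
        (∑ j, fidelityCoeff τ (V j) (Matrix.of fun c a => bellVec j (c, a)) q p c c') *
        ((blochVec θ φ q * star (blochVec θ φ p)) *
          (blochVec θ φ c * star (blochVec θ φ c')))).re := by
    intro θ φ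
    simp only [inputFidelity, sandwich_bobState, ← Complex.re_sum]
    congr 1
    simp only [Finset.sum_mul]
    rw [Finset.sum_comm]
    refine Finset.sum_congr rfl fun q _ => ?_
    rw [Finset.sum_comm]
    refine Finset.sum_congr rfl fun p _ => ?_
    rw [Finset.sum_comm]
    refine Finset.sum_congr rfl fun c _ => ?_
    rw [Finset.sum_comm]
  rw [fidelityWith]
  simp_rw [key]
  rw [bloch_average]
  have swap : ∀ f : Fin 2 → Fin 2 → Fin 4 → ℂ,
      ∑ q, ∑ c, ∑ j, f q c j = ∑ j, ∑ q, ∑ c, f q c j := by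
    intro f
    simp only [Fin.sum_univ_two, Fin.sum_univ_four]
    ring
  have h1 : ∑ q, ∑ c, ∑ j, fidelityCoeff τ (V j) (Matrix.of fun c a => bellVec j (c, a)) q q c c =
      2 * τ.trace := by
    rw [swap fun q c j =>
      fidelityCoeff τ (V j) (Matrix.of fun c a => bellVec j (c, a)) q q c c]
    simp_rw [sum_fidelityCoeff_trace]
    simp
    ring
  have h2 : (∑ q, ∑ c, ∑ j,
      fidelityCoeff τ (V j) (Matrix.of fun c a => bellVec j (c, a)) q c c q).re =
      ∑ j, bellOverlap τ ((pauliUnitary j)⁻¹ * V j) := by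
    rw [swap fun q c j =>
      fidelityCoeff τ (V j) (Matrix.of fun c a => bellVec j (c, a)) q c c q, Complex.re_sum]
    simp_rw [sum_fidelityCoeff_overlap]
  rw [Complex.add_re, h1, h2]
  simp
  ring

/-- A real supremum over an unbounded set would be the default value `0`. Unitary entries have
modulus at most one, which bounds the set. -/
theorem bddAbove_bellOverlap (τ : PairOp) :
    BddAbove (Set.range fun U : Matrix.unitaryGroup (Fin 2) ℂ => bellOverlap τ U) := by
  refine ⟨(∑ b, ∑ b', ∑ a, ∑ a', ‖τ (a, b) (a', b')‖) / 2, ?_⟩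
  rintro _ ⟨U, rfl⟩
  simp only [bellOverlap_eq]
  gcongr
  refine (Complex.re_le_norm _).trans ?_
  refine (norm_sum_le _ _).trans (Finset.sum_le_sum fun b _ => ?_)
  refine (norm_sum_le _ _).trans (Finset.sum_le_sum fun b' _ => ?_)
  refine (norm_sum_le _ _).trans (Finset.sum_le_sum fun a _ => ?_)
  refine (norm_sum_le _ _).trans (Finset.sum_le_sum fun a' _ => ?_)
  have h1 := entry_norm_bound_of_unitary U.2 a b
  have h2 := entry_norm_bound_of_unitary U.2 a' b'
  rw [norm_mul, norm_mul, norm_star]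
  exact mul_le_of_le_one_left (norm_nonneg _) (mul_le_one₀ h1 (norm_nonneg _) h2)

theorem bellOverlap_le (τ : PairOp) (U : Matrix.unitaryGroup (Fin 2) ℂ) :
    bellOverlap τ U ≤ fullyEntangledFraction τ :=
  le_ciSup (bddAbove_bellOverlap τ) U

theorem fidelityWith_le (τ : PairOp) (V : Fin 4 → Matrix.unitaryGroup (Fin 2) ℂ) :
    fidelityWith τ V ≤ (τ.trace.re + 2 * fullyEntangledFraction τ) / 3 := by
  rw [fidelityWith_eq, Fin.sum_univ_four]
  have := fun j => bellOverlap_le τ ((pauliUnitary j)⁻¹ * V j)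
  linarith [this 0, this 1, this 2, this 3]

theorem fidelityWith_le_teleportFidelity (τ : PairOp)
    (V : Fin 4 → Matrix.unitaryGroup (Fin 2) ℂ) : fidelityWith τ V ≤ teleportFidelity τ :=
  le_ciSup (f := fun V => fidelityWith τ V)
    ⟨_, by rintro _ ⟨V, rfl⟩; exact fidelityWith_le τ V⟩ V

/-- Undoing Alice's Pauli makes all four Bell results contribute the same overlap, so the bound by
the fully entangled fraction can be approached. -/
theorem fidelityWith_pauli_mul (τ : PairOp) (U : Matrix.unitaryGroup (Fin 2) ℂ) :
    fidelityWith τ (fun j => pauliUnitary j * U) = (τ.trace.re + 2 * bellOverlap τ U) / 3 := by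
  rw [fidelityWith_eq]
  simp only [inv_mul_cancel_left, Finset.sum_const, Finset.card_univ, Fintype.card_fin,
    nsmul_eq_mul]
  push_cast
  ring

theorem teleportFidelity_eq (τ : PairOp) :
    teleportFidelity τ = (τ.trace.re + 2 * fullyEntangledFraction τ) / 3 := by
  refine le_antisymm (ciSup_le fun V => fidelityWith_le τ V) ?_
  have : fullyEntangledFraction τ ≤ (3 * teleportFidelity τ - τ.trace.re) / 2 :=
    ciSup_le fun U => by
      have := fidelityWith_le_teleportFidelity τ (fun j => pauliUnitary j * U)
      rw [fidelityWith_pauli_mul] at this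
      linarith
  linarith

/-! ### Expectation values -/

section Expectation

variable {ι : Type} [Fintype ι]

theorem sandwich_add (v : ι → ℂ) (M N : Matrix ι ι ℂ) :
    sandwich v (M + N) = sandwich v M + sandwich v N := by
  simp [sandwich, Matrix.add_mulVec]

theorem sandwich_smul (v : ι → ℂ) (r : ℝ) (M : Matrix ι ι ℂ) :
    sandwich v ((r : ℂ) • M) = r * sandwich v M := by
  simp [sandwich, Matrix.smul_mulVec]

theorem sandwich_sum {κ : Type} (s : Finset κ) (v : ι → ℂ) (M : κ → Matrix ι ι ℂ) :
    sandwich v (∑ j ∈ s, M j) = ∑ j ∈ s, sandwich v (M j) := by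
  simp [sandwich, Matrix.sum_mulVec, dotProduct_sum]

theorem sandwich_nonneg {M : Matrix ι ι ℂ} (hM : M.PosSemidef) (v : ι → ℂ) : 0 ≤ sandwich v M :=
  (Complex.le_def.1 (hM.dotProduct_mulVec_nonneg v)).1

theorem sandwich_vecMulVec (v u : ι → ℂ) :
    sandwich v (Matrix.vecMulVec u (star u)) = Complex.normSq (star u ⬝ᵥ v) := by
  have h : star v ⬝ᵥ u = star (star u ⬝ᵥ v) := by
    rw [Matrix.star_dotProduct]
  rw [sandwich, Matrix.vecMulVec_mulVec, dotProduct_smul]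
  rw [h]
  simp [Complex.normSq_apply]

theorem expect_vecMulVec_left (v : ι → ℂ) (ρ : Matrix ι ι ℂ) :
    expect (Matrix.vecMulVec v (star v)) ρ = sandwich v ρ := by
  rw [expect, sandwich, Matrix.vecMulVec_mul, Matrix.trace_vecMulVec, dotProduct_comm,
    Matrix.dotProduct_mulVec]

end Expectation

/-! ### The graph basis -/

/-- The sign `(-1) ^ a`. -/
def bitSign (a : Fin 2) : ℝ := if a = 1 then -1 else 1

/-- The basis vector `Z ^ w |Cₙ⟩`. -/
def graphVec {n : ℕ} (w x : Fin n → Fin 2) : ℂ :=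
  (∏ i, if w i = 1 then (bitSign (x i) : ℂ) else 1) * clusterVec n x

theorem bitSign_mul_self (a : Fin 2) : bitSign a * bitSign a = 1 := by
  fin_cases a <;> simp [bitSign]

theorem star_clusterVec (n : ℕ) (x : Fin n → Fin 2) :
    star (clusterVec n x) = clusterVec n x := by
  simp only [clusterVec, Complex.star_def, map_mul, map_pow, Complex.conj_ofReal, map_prod]
  congr 1
  refine Finset.prod_congr rfl fun i _ => Finset.prod_congr rfl fun j _ => ?_
  split_ifs <;> simp

theorem clusterVec_mul_self (n : ℕ) (x : Fin n → Fin 2) :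
    clusterVec n x * clusterVec n x = (1 / 2) ^ n := by
  rw [clusterVec, mul_mul_mul_comm, ← mul_pow, inv_sqrt_two_mul_self, ← Finset.prod_mul_distrib]
  refine (congrArg _ (Finset.prod_eq_one fun i _ => ?_)).trans (mul_one _)
  rw [← Finset.prod_mul_distrib]
  refine Finset.prod_eq_one fun j _ => ?_
  split_ifs <;> simp

/-- The controlled-`Z` signs of `x` and `y` cancel on every edge that avoids `i`. An edge at `i` is
seen by exactly one of the two strings and leaves the sign of the neighbour: this is where the `Z`s
of the generator come from. -/
theorem clusterVec_mul_of_flip {n : ℕ} (i : Fin n) (x y : Fin n → Fin 2) (hi : x i ≠ y i)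
    (h : ∀ j, j ≠ i → x j = y j) :
    clusterVec n x * clusterVec n y = (1 / 2) ^ n *
      ∏ j : Fin n, if (j : ℕ) + 1 = (i : ℕ) ∨ (i : ℕ) + 1 = (j : ℕ) then (bitSign (x j) : ℂ)
        else 1 := by
  have key : ∀ a b : Fin n,
      ((if (a : ℕ) + 1 = (b : ℕ) ∧ x a = 1 ∧ x b = 1 then (-1 : ℂ) else 1) *
        if (a : ℕ) + 1 = (b : ℕ) ∧ y a = 1 ∧ y b = 1 then (-1 : ℂ) else 1) =
      (if a = i ∧ (i : ℕ) + 1 = b then (bitSign (x b) : ℂ) else 1) *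
        if b = i ∧ (a : ℕ) + 1 = i then (bitSign (x a) : ℂ) else 1 := by
    intro a b
    by_cases hab : (a : ℕ) + 1 = b
    · have two : ∀ s t : Fin 2, s ≠ t → (s = 0 ∧ t = 1) ∨ (s = 1 ∧ t = 0) := by decide
      have two' : ∀ s : Fin 2, s = 0 ∨ s = 1 := by decide
      by_cases hai : a = i
      · subst hai
        have hb : b ≠ a := by rintro rfl; omega
        have hb' := h b hb
        rcases two _ _ hi with ⟨h1, h2⟩ | ⟨h1, h2⟩ <;> rcases two' (x b) with h3 | h3 <;>
          simp [hab, hb, h1, h2, h3, ← hb', bitSign]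
      · by_cases hbi : b = i
        · subst hbi
          have ha' := h a hai
          rcases two _ _ hi with ⟨h1, h2⟩ | ⟨h1, h2⟩ <;> rcases two' (x a) with h3 | h3 <;>
            simp [hab, hai, h1, h2, h3, ← ha', bitSign]
        · have ha' := h a hai
          have hb' := h b hbi
          rw [← ha', ← hb']
          simp only [hai, hbi, false_and, if_false]
          split_ifs <;> simp
    · have h1 : ¬ (a = i ∧ (i : ℕ) + 1 = b) := by rintro ⟨rfl, h⟩; exact hab h
      have h2 : ¬ (b = i ∧ (a : ℕ) + 1 = i) := by rintro ⟨rfl, h⟩; exact hab h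
      simp [hab, h1, h2]
  rw [clusterVec, clusterVec, mul_mul_mul_comm, ← mul_pow, inv_sqrt_two_mul_self,
    ← Finset.prod_mul_distrib]
  congr 1
  simp_rw [← Finset.prod_mul_distrib, key, Finset.prod_mul_distrib]
  have e1 : ∏ a : Fin n, ∏ b : Fin n,
      (if a = i ∧ (i : ℕ) + 1 = b then (bitSign (x b) : ℂ) else 1) =
      ∏ b : Fin n, if (i : ℕ) + 1 = b then (bitSign (x b) : ℂ) else 1 := by
    rw [Finset.prod_eq_single i (fun j _ hj => by simp [hj]) (by simp)]
    simp
  have e2 : ∏ a : Fin n, ∏ b : Fin n,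
      (if b = i ∧ (a : ℕ) + 1 = i then (bitSign (x a) : ℂ) else 1) =
      ∏ a : Fin n, if (a : ℕ) + 1 = i then (bitSign (x a) : ℂ) else 1 := by
    rw [Finset.prod_comm, Finset.prod_eq_single i (fun j _ hj => by simp [hj]) (by simp)]
    simp
  rw [e1, e2, ← Finset.prod_mul_distrib]
  refine Finset.prod_congr rfl fun j _ => ?_
  by_cases h1 : (i : ℕ) + 1 = j
  · have h2 : ¬ ((j : ℕ) + 1 = i) := by omega
    simp [h1, h2]
  · simp [h1]

theorem sum_prod_bits {n : ℕ} (f : Fin n → Fin 2 → ℂ) :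
    ∑ w : Fin n → Fin 2, ∏ i, f i (w i) = ∏ i, ∑ a, f i a := by
  rw [Finset.prod_univ_sum, Fintype.piFinset_univ]

theorem star_graphVec {n : ℕ} (w x : Fin n → Fin 2) : star (graphVec w x) = graphVec w x := by
  rw [graphVec, star_mul', star_clusterVec, Complex.star_def, map_prod]
  congr 1
  refine Finset.prod_congr rfl fun i _ => ?_
  split_ifs <;> simp

theorem graphVec_mul {n : ℕ} (w x y : Fin n → Fin 2) :
    graphVec w x * graphVec w y = (∏ i, if w i = 1 then (bitSign (x i) * bitSign (y i) : ℂ) else 1) *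
      (clusterVec n x * clusterVec n y) := by
  rw [graphVec, graphVec, mul_mul_mul_comm, ← Finset.prod_mul_distrib]
  congr 1
  refine Finset.prod_congr rfl fun i _ => ?_
  split_ifs <;> simp

/-- The sum over `w` factorizes over the sites, and the factor `1 + (±1)(±1)` vanishes where `x` and
`y` differ. -/
theorem sum_graphProj (n : ℕ) :
    ∑ w : Fin n → Fin 2, Matrix.vecMulVec (graphVec w) (star (graphVec w)) = 1 := by
  ext x y
  simp only [Matrix.sum_apply, Matrix.vecMulVec_apply, Pi.star_apply, star_graphVec, graphVec_mul]
  rw [← Finset.sum_mul,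
    sum_prod_bits fun i a => if a = 1 then (bitSign (x i) * bitSign (y i) : ℂ) else 1]
  by_cases hxy : x = y
  · subst hxy
    simp [clusterVec_mul_self, ← Complex.ofReal_mul, bitSign_mul_self]
  · obtain ⟨j, hj⟩ := Function.ne_iff.1 hxy
    rw [Finset.prod_eq_zero (Finset.mem_univ j), zero_mul, Matrix.one_apply_ne hxy]
    revert hj
    generalize x j = a
    generalize y j = b
    intro hj
    fin_cases a <;> fin_cases b <;> simp_all [bitSign]

/-- Spectral decomposition of the generator. The eigenvalue sign turns the factor of site `i` in the
completeness sum into `1 - (±1)(±1)`, which vanishes unless bit `i` is flipped; the other sites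
still force equality. -/
theorem gen_eq_sum {n : ℕ} (i : Fin n) :
    gen i = ∑ w : Fin n → Fin 2,
      (bitSign (w i) : ℂ) • Matrix.vecMulVec (graphVec w) (star (graphVec w)) := by
  have hw : ∀ w x y : Fin n → Fin 2, (bitSign (w i) : ℂ) *
      ((∏ j, if w j = 1 then (bitSign (x j) * bitSign (y j) : ℂ) else 1) *
      (clusterVec n x * clusterVec n y)) =
      (∏ j, (if w j = 1 then (bitSign (x j) * bitSign (y j) : ℂ) else 1) *
        if j = i then (bitSign (w j) : ℂ) else 1) * (clusterVec n x * clusterVec n y) := by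
    intro w x y
    rw [Finset.prod_mul_distrib, Finset.prod_ite_eq' Finset.univ i, if_pos (Finset.mem_univ _)]
    ring
  have two : ∀ a b : Fin 2, a ≠ b → (a = 0 ∧ b = 1) ∨ (a = 1 ∧ b = 0) := by decide
  ext x y
  simp only [Matrix.sum_apply, Matrix.smul_apply, Matrix.vecMulVec_apply, Pi.star_apply,
    star_graphVec, graphVec_mul, smul_eq_mul, hw]
  rw [← Finset.sum_mul, sum_prod_bits fun j a =>
    (if a = 1 then (bitSign (x j) * bitSign (y j) : ℂ) else 1) *
      if j = i then (bitSign a : ℂ) else 1]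
  simp only [gen, tensor, Matrix.of_apply]
  by_cases hi : x i = y i
  · rw [Finset.prod_eq_zero (Finset.mem_univ i), Finset.prod_eq_zero (Finset.mem_univ i), zero_mul]
    · simp [hi, ← Complex.ofReal_mul, bitSign_mul_self]
      simp [bitSign]
    · rw [if_pos rfl, hi]
      generalize y i = a
      fin_cases a <;> simp [pauliX]
  by_cases h : ∀ j, j ≠ i → x j = y j
  · rw [clusterVec_mul_of_flip i x y hi h]
    have hr : ∀ j, (∑ a, (if a = 1 then (bitSign (x j) * bitSign (y j) : ℂ) else 1) *
      if j = i then (bitSign a : ℂ) else 1) = 2 := by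
      intro j
      by_cases hj : j = i
      · subst hj
        rcases two _ _ hi with ⟨h1, h2⟩ | ⟨h1, h2⟩ <;> simp [h1, h2, bitSign] <;> norm_num
      · rw [← h j hj]
        simp [hj, ← Complex.ofReal_mul, bitSign_mul_self]
    simp only [hr]
    rw [Finset.prod_const, Finset.card_univ, Fintype.card_fin, ← mul_assoc, ← mul_pow]
    norm_num
    refine Finset.prod_congr rfl fun j _ => ?_
    by_cases hj : j = i
    · subst hj
      rcases two _ _ hi with ⟨h1, h2⟩ | ⟨h1, h2⟩ <;> simp [h1, h2, pauliX]
    · rw [← h j hj, if_neg hj]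
      split_ifs
      · generalize x j = a
        fin_cases a <;> simp [pauliZ, bitSign]
      · simp
  · push Not at h
    obtain ⟨j, hj, hxy⟩ := h
    rw [Finset.prod_eq_zero (Finset.mem_univ j), Finset.prod_eq_zero (Finset.mem_univ j), zero_mul]
    · rcases two _ _ hxy with ⟨h1, h2⟩ | ⟨h1, h2⟩ <;> simp [h1, h2, hj, bitSign]
    · rw [if_neg hj]
      split_ifs <;> rcases two _ _ hxy with ⟨h1, h2⟩ | ⟨h1, h2⟩ <;> simp [h1, h2, pauliZ]

theorem graphVec_zero (n : ℕ) : graphVec (0 : Fin n → Fin 2) = clusterVec n := by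
  ext x
  simp [graphVec]

theorem graphVec_single {n : ℕ} (i : Fin n) (x : Fin n → Fin 2) :
    graphVec (Pi.single i 1) x = bitSign (x i) * clusterVec n x := by
  rw [graphVec]
  congr 1
  rw [Finset.prod_eq_single i]
  · simp
  · intro j _ hj
    simp [hj]
  · simp

theorem graphVec_orthonormal {n : ℕ} (w w' : Fin n → Fin 2) :
    star (graphVec w) ⬝ᵥ graphVec w' = if w = w' then 1 else 0 := by
  have h : ∀ x : Fin n → Fin 2, graphVec w x * graphVec w' x =
      (∏ i, (if w i = 1 then (bitSign (x i) : ℂ) else 1) *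
        if w' i = 1 then (bitSign (x i) : ℂ) else 1) * (1 / 2) ^ n := by
    intro x
    rw [graphVec, graphVec, mul_mul_mul_comm, clusterVec_mul_self, Finset.prod_mul_distrib]
  simp only [dotProduct, Pi.star_apply, star_graphVec, h]
  rw [← Finset.sum_mul, sum_prod_bits fun i a => (if w i = 1 then (bitSign a : ℂ) else 1) *
        if w' i = 1 then (bitSign a : ℂ) else 1]
  by_cases hw : w = w'
  · subst hw
    have : ∀ i, (∑ a, (if w i = 1 then (bitSign a : ℂ) else 1) *
        if w i = 1 then (bitSign a : ℂ) else 1) = 2 := by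
      intro i
      split_ifs <;> norm_num [bitSign]
    rw [Finset.prod_congr rfl fun i _ => this i]
    simp
  · obtain ⟨j, hj⟩ := Function.ne_iff.1 hw
    rw [if_neg hw, Finset.prod_eq_zero (Finset.mem_univ j), zero_mul]
    revert hj
    generalize w j = a
    generalize w' j = b
    intro hj
    fin_cases a <;> fin_cases b <;> simp_all [bitSign]

/-- The projector onto a graph basis vector is the cluster projector conjugated by `Z`s. -/
theorem opZ_mul_clusterProj_mul {n : ℕ} (i : Fin n) :
    opZ i * clusterProj n * opZ i = Matrix.vecMulVec (graphVec (Pi.single i 1))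
      (star (graphVec (Pi.single i 1))) := by
  have hd : opZ i = Matrix.diagonal fun x : Fin n → Fin 2 => (bitSign (x i) : ℂ) := by
    ext x y
    rw [opZ, tensor, Matrix.of_apply]
    by_cases hxy : x = y
    · subst hxy
      rw [Matrix.diagonal_apply_eq, Finset.prod_eq_single i]
      · generalize x i = a
        fin_cases a <;> simp [pauliZ, bitSign]
      · intro j _ hj
        simp [hj]
      · simp
    · obtain ⟨j, hj⟩ := Function.ne_iff.1 hxy
      rw [Matrix.diagonal_apply_ne _ hxy, Finset.prod_eq_zero (Finset.mem_univ j)]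
      split_ifs
      · revert hj
        generalize x j = a
        generalize y j = b
        fin_cases a <;> fin_cases b <;> simp [pauliZ]
      · simp [hj]
  ext x y
  rw [hd, clusterProj, Matrix.mul_diagonal, Matrix.diagonal_mul]
  rw [Matrix.vecMulVec_apply, Matrix.vecMulVec_apply, Pi.star_apply, Pi.star_apply,
    star_graphVec, star_clusterVec, graphVec_single, graphVec_single]
  ring

theorem expect_gen_eq_sum {n : ℕ} (i : Fin n) (ρ : Op n) :
    expect (gen i) ρ = ∑ w : Fin n → Fin 2, bitSign (w i) * sandwich (graphVec w) ρ := by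
  simp_rw [gen_eq_sum, ← expect_vecMulVec_left]
  simp [expect, Finset.sum_mul, Matrix.trace_sum]

theorem sum_sandwich_graphVec {n : ℕ} (ρ : Op n) :
    ∑ w : Fin n → Fin 2, sandwich (graphVec w) ρ = ρ.trace.re := by
  simp_rw [← expect_vecMulVec_left, expect, ← Complex.re_sum, ← Matrix.trace_sum, ← Finset.sum_mul,
    sum_graphProj, one_mul]

/-- Every nonzero bit costs `2`. Equality holds for a single error, which is why the worst-case
state mixes in exactly these. -/
theorem sum_bitSign_le {n : ℕ} (w : Fin n → Fin 2) (hw : w ≠ 0) :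
    ∑ i, bitSign (w i) ≤ n - 2 := by
  obtain ⟨j, hj⟩ := Function.ne_iff.1 hw
  have hj1 : w j = 1 := by
    revert hj
    simp only [Pi.zero_apply]
    generalize w j = a
    revert a
    decide
  have h : ∀ i, bitSign (w i) ≤ 1 - if i = j then 2 else 0 := by
    intro i
    split_ifs with hi
    · subst hi
      norm_num [hj1, bitSign]
    · rw [bitSign]
      split_ifs <;> norm_num
  refine (Finset.sum_le_sum fun i _ => h i).trans ?_
  simp

theorem sum_bitSign_single {n : ℕ} (i : Fin n) :
    ∑ j, bitSign ((Pi.single j 1 : Fin n → Fin 2) i) = n - 2 := by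
  have h : ∀ j, bitSign ((Pi.single j 1 : Fin n → Fin 2) i) = 1 - if i = j then 2 else 0 := by
    intro j
    rw [Pi.single_apply]
    split_ifs <;> norm_num [bitSign]
  simp [h]

/-- The fidelity with the cluster state is bounded by the generator expectation values. -/
theorem le_sandwich_clusterVec {n : ℕ} {c : ℝ} {ρ : Op n} (hρ : IsState ρ)
    (h : ∀ i, c ≤ expect (gen i) ρ) : 1 - n * (1 - c) / 2 ≤ sandwich (clusterVec n) ρ := by
  have h1 : n * c ≤ ∑ i, expect (gen i) ρ := by
    simpa using Finset.card_nsmul_le_sum Finset.univ (fun i => expect (gen i) ρ) c fun i _ => h i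
  have h2 := sum_sandwich_graphVec ρ
  rw [hρ.2, Complex.one_re] at h2
  simp_rw [expect_gen_eq_sum] at h1
  rw [Finset.sum_comm] at h1
  -- The operator inequality `∑ Kᵢ ≤ (n - 2) + 2|Cₙ⟩⟨Cₙ|`, read in the graph basis.
  have h3 : ∀ w : Fin n → Fin 2, ∑ i, bitSign (w i) * sandwich (graphVec w) ρ ≤
      (n - 2) * sandwich (graphVec w) ρ + if w = 0 then 2 * sandwich (graphVec w) ρ else 0 := by
    intro w
    rw [← Finset.sum_mul]
    by_cases hw : w = 0
    · subst hw
      simp [bitSign]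
      linarith
    · simp only [hw, if_false, add_zero]
      exact mul_le_mul_of_nonneg_right (sum_bitSign_le w hw) (sandwich_nonneg hρ.1 _)
  have h4 := h1.trans (Finset.sum_le_sum fun w _ => h3 w)
  rw [Finset.sum_add_distrib, ← Finset.mul_sum, h2, Finset.sum_ite_eq' Finset.univ 0,
    if_pos (Finset.mem_univ _), graphVec_zero] at h4
  linarith

/-! ### The worst-case state -/

theorem wcState_eq (n : ℕ) (c : ℝ) :
    wcState n c = (wcWeight n c : ℂ) • Matrix.vecMulVec (clusterVec n) (star (clusterVec n)) +
      (((1 - wcWeight n c) / n : ℝ) : ℂ) • ∑ i : Fin n,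
        Matrix.vecMulVec (graphVec (Pi.single i 1)) (star (graphVec (Pi.single i 1))) := by
  simp_rw [wcState, opZ_mul_clusterProj_mul]
  rfl

theorem trace_graphProj {n : ℕ} (w : Fin n → Fin 2) :
    (Matrix.vecMulVec (graphVec w) (star (graphVec w))).trace = 1 := by
  rw [Matrix.trace_vecMulVec, dotProduct_comm, graphVec_orthonormal, if_pos rfl]

theorem isState_wcState {n : ℕ} (hn : n ≠ 0) {c : ℝ} (h0 : 0 ≤ wcWeight n c)
    (h1 : wcWeight n c ≤ 1) : IsState (wcState n c) := by
  have hn' : (n : ℝ) ≠ 0 := Nat.cast_ne_zero.2 hn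
  constructor
  · rw [wcState_eq]
    refine Matrix.PosSemidef.add ?_ ?_
    · exact (Matrix.posSemidef_vecMulVec_self_star _).smul (Complex.zero_le_real.2 h0)
    · refine Matrix.PosSemidef.smul (Matrix.posSemidef_sum _ fun i _ =>
        Matrix.posSemidef_vecMulVec_self_star _) (Complex.zero_le_real.2 ?_)
      exact div_nonneg (by linarith) (Nat.cast_nonneg n)
  · rw [wcState_eq, ← graphVec_zero, Matrix.trace_add, Matrix.trace_smul, Matrix.trace_smul,
      Matrix.trace_sum]
    simp only [trace_graphProj]
    simp only [smul_eq_mul, Finset.sum_const, Finset.card_univ, Fintype.card_fin, nsmul_eq_mul,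
      mul_one]
    norm_cast
    field_simp
    ring

theorem expect_gen_graphProj {n : ℕ} (i : Fin n) (w : Fin n → Fin 2) :
    expect (gen i) (Matrix.vecMulVec (graphVec w) (star (graphVec w))) = bitSign (w i) := by
  rw [expect_gen_eq_sum]
  simp_rw [sandwich_vecMulVec, graphVec_orthonormal]
  rw [Finset.sum_eq_single w]
  · simp
  · intro w' _ hw
    simp [hw.symm]
  · simp

theorem expect_add_right {ι : Type} [Fintype ι] (A M N : Matrix ι ι ℂ) :
    expect A (M + N) = expect A M + expect A N := by
  simp [expect, mul_add]

theorem expect_smul_right {ι : Type} [Fintype ι] (A : Matrix ι ι ℂ) (r : ℝ) (M : Matrix ι ι ℂ) :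
    expect A ((r : ℂ) • M) = r * expect A M := by
  simp [expect]

theorem expect_sum_right {ι κ : Type} [Fintype ι] (A : Matrix ι ι ℂ) (s : Finset κ)
    (M : κ → Matrix ι ι ℂ) : expect A (∑ j ∈ s, M j) = ∑ j ∈ s, expect A (M j) := by
  simp [expect, Finset.mul_sum, Matrix.trace_sum]

/-- Of the `n` single errors only the one at `i` flips `Kᵢ`, so the value is `λ + (1 - λ)(n - 2)/n`;
`wcWeight` solves this for `c`. -/
theorem expect_gen_wcState {n : ℕ} (c : ℝ) (i : Fin n) :
    expect (gen i) (wcState n c) = c := by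
  have hn' : (n : ℝ) ≠ 0 := Nat.cast_ne_zero.2 (by have := i.2; omega)
  rw [wcState_eq, ← graphVec_zero, expect_add_right, expect_smul_right, expect_smul_right,
    expect_sum_right]
  simp_rw [expect_gen_graphProj]
  rw [sum_bitSign_single, wcWeight]
  simp [bitSign]
  field_simp
  ring

/-! ### Lines of `k + 2` sites -/

section Frame

variable {α : Type} {k : ℕ} (a : α) (z : Fin k → α) (b : α)

@[simp] theorem frame_zero : frame a z b 0 = a := rfl

@[simp] theorem frame_last : frame a z b (Fin.last (k + 1)) = b := by
  rw [frame, ← Fin.succ_last, Fin.cons_succ, Fin.snoc_last]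

@[simp] theorem frame_inner (i : Fin k) : frame a z b i.castSucc.succ = z i := by
  rw [frame, Fin.cons_succ, Fin.snoc_castSucc]

end Frame

theorem prod_frame {M : Type} [CommMonoid M] {k : ℕ} (F : Fin (k + 2) → M) :
    ∏ j, F j = F 0 * ((∏ i : Fin k, F i.castSucc.succ) * F (Fin.last (k + 1))) := by
  rw [Fin.prod_univ_succ, Fin.prod_univ_castSucc, Fin.succ_last]

theorem forall_frame {k : ℕ} {p : Fin (k + 2) → Prop} (h0 : p 0)
    (hi : ∀ i : Fin k, p i.castSucc.succ) (hl : p (Fin.last (k + 1))) : ∀ j, p j :=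
  Fin.cases h0 (Fin.lastCases (by rwa [Fin.succ_last]) hi)

/-! ### The isometry that belongs to an outcome string -/

/-- The unnormalized eigenvectors of the measured observables. -/
def measPhase (b : MeasBasis) (s x : Fin 2) : ℂ :=
  if x = 1 then (bitSign s : ℂ) * (match b with | .X => 1 | .Y => Complex.I) else 1

theorem star_measPhase_mul (b : MeasBasis) (s x : Fin 2) :
    star (measPhase b s x) * measPhase b s x = 1 := by
  cases b <;> fin_cases s <;> fin_cases x <;> simp [measPhase, bitSign]

/-- The normalized eigenvectors of the measured observables. -/
def measVec (b : MeasBasis) (s x : Fin 2) : ℂ :=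
  ((1 / Real.sqrt 2 : ℝ) : ℂ) * measPhase b s x

theorem measVec_mul_star (b : MeasBasis) (s x y : Fin 2) :
    measVec b s x * star (measVec b s y) = outcomeProj b s x y := by
  rw [measVec, measVec, star_mul', mul_mul_mul_comm, Complex.star_def, Complex.conj_ofReal,
    inv_sqrt_two_mul_self]
  cases b <;> fin_cases s <;> fin_cases x <;> fin_cases y <;>
    simp [measPhase, bitSign, outcomeProj, MeasBasis.obs, pauliX, pauliY]

theorem sum_star_measVec_mul (b : MeasBasis) (s : Fin 2) :
    ∑ x, star (measVec b s x) * measVec b s x = 1 := by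
  have : ∀ x, star (measVec b s x) * measVec b s x = 1 / 2 := by
    intro x
    rw [measVec, star_mul', mul_mul_mul_comm, star_measPhase_mul, Complex.star_def,
      Complex.conj_ofReal, inv_sqrt_two_mul_self, mul_one]
  rw [Finset.sum_congr rfl fun x _ => this x]
  simp

theorem sum_outcomeProj (b : MeasBasis) : ∑ s, outcomeProj b s = 1 := by
  rw [Fin.sum_univ_two, outcomeProj, outcomeProj, ← smul_add]
  ext x y
  simp
  ring

/-- The isometry from the outer pair of qubits that puts the inner qubits into the eigenstate that
belongs to the outcome string `s`. -/
def embed {k : ℕ} (m : Fin k → MeasBasis) (s : Fin k → Fin 2) :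
    Matrix (Fin (k + 2) → Fin 2) (Fin 2 × Fin 2) ℂ :=
  Matrix.of fun x p => ∏ j,
    frame (Pi.single p.1 1) (fun i => measVec (m i) (s i)) (Pi.single p.2 1) j (x j)

section Embed

variable {k : ℕ} (m : Fin k → MeasBasis) (s : Fin k → Fin 2)

theorem embed_apply (x : Fin (k + 2) → Fin 2) (p : Fin 2 × Fin 2) :
    embed m s x p = (Pi.single p.1 1 : Fin 2 → ℂ) (x 0) *
      ((∏ i, measVec (m i) (s i) (x i.castSucc.succ)) *
        (Pi.single p.2 1 : Fin 2 → ℂ) (x (Fin.last (k + 1)))) := by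
  rw [embed, Matrix.of_apply, prod_frame]
  simp

/-- Inner outcomes have rank one, and the sum over the outer basis supplies the two identity
factors. -/
theorem embed_mul_conjTranspose : embed m s * (embed m s).conjTranspose = measProj m s := by
  ext x y
  rw [Matrix.mul_apply, measProj, tensor, Matrix.of_apply, prod_frame]
  simp only [Matrix.conjTranspose_apply, embed_apply, frame_zero, frame_inner, frame_last,
    ← measVec_mul_star, Finset.prod_mul_distrib, star_mul', star_prod, Fintype.sum_prod_type]
  generalize ∏ i, measVec (m i) (s i) (x i.castSucc.succ) = A
  generalize ∏ i, star (measVec (m i) (s i) (y i.castSucc.succ)) = B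
  generalize x 0 = x0
  generalize y 0 = y0
  generalize x (Fin.last (k + 1)) = x1
  generalize y (Fin.last (k + 1)) = y1
  fin_cases x0 <;> fin_cases y0 <;> fin_cases x1 <;> fin_cases y1 <;>
    simp [Pi.single_apply]

theorem sum_measProj : ∑ s, measProj m s = 1 := by
  ext x y
  rw [Matrix.sum_apply]
  simp only [measProj, tensor, Matrix.of_apply, prod_frame, frame_zero, frame_inner, frame_last]
  rw [← Finset.mul_sum, ← Finset.sum_mul,
    sum_prod_bits fun i a => outcomeProj (m i) a (x i.castSucc.succ) (y i.castSucc.succ)]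
  simp_rw [← Matrix.sum_apply, sum_outcomeProj]
  by_cases hxy : x = y
  · subst hxy
    simp
  · rw [Matrix.one_apply_ne hxy]
    have : ¬ (x 0 = y 0 ∧ (∀ i : Fin k, x i.castSucc.succ = y i.castSucc.succ) ∧
        x (Fin.last (k + 1)) = y (Fin.last (k + 1))) :=
      fun h => hxy (funext (forall_frame h.1 h.2.1 h.2.2))
    by_cases h0 : x 0 = y 0
    · by_cases h1 : x (Fin.last (k + 1)) = y (Fin.last (k + 1))
      · have h2 : ∃ i : Fin k, x i.castSucc.succ ≠ y i.castSucc.succ := by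
          by_contra! h
          exact this ⟨h0, h, h1⟩
        obtain ⟨i, hi⟩ := h2
        rw [Finset.prod_eq_zero (Finset.mem_univ i) (by rw [Matrix.one_apply, if_neg hi])]
        simp
      · rw [Matrix.one_apply (i := x (Fin.last (k + 1))), if_neg h1]
        simp
    · rw [Matrix.one_apply (i := x 0), if_neg h0]
      simp

/-- The inner qubits are in a normalized product vector independent of the outer pair, so tracing
them out costs nothing. Partial traces can then be replaced by compressions with `embed`. -/
theorem traceInner_embed (N : PairOp) :
    traceInner (embed m s * N * (embed m s).conjTranspose) = N := by
  have h : ∀ (z : Fin k → Fin 2) (p q : Fin 2 × Fin 2), embed m s (frame p.1 z p.2) q =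
      if q = p then ∏ i, measVec (m i) (s i) (z i) else 0 := by
    intro z p q
    obtain ⟨p1, p2⟩ := p
    obtain ⟨q1, q2⟩ := q
    simp only [embed_apply, frame_zero, frame_inner, frame_last, Pi.single_apply, Prod.mk.injEq]
    split_ifs <;> simp_all
  ext p q
  rw [traceInner, Matrix.of_apply]
  simp only [Matrix.mul_apply, Matrix.conjTranspose_apply, h]
  simp only [ite_mul, zero_mul, Finset.sum_ite_eq', Finset.mem_univ, if_true, apply_ite star,
    star_zero, mul_ite, mul_zero]
  have : ∀ z : Fin k → Fin 2, (∏ i, measVec (m i) (s i) (z i)) * N p q *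
      star (∏ i, measVec (m i) (s i) (z i)) =
      N p q * ∏ i, star (measVec (m i) (s i) (z i)) * measVec (m i) (s i) (z i) := by
    intro z
    rw [Finset.prod_mul_distrib, star_prod]
    ring
  simp_rw [this]
  rw [← Finset.mul_sum, sum_prod_bits fun i a =>
    star (measVec (m i) (s i) a) * measVec (m i) (s i) a]
  simp_rw [sum_star_measVec_mul]
  simp

/-- The unnormalized state of the outer pair of qubits after the outcome string `s`. -/
def outerState (ρ : Op (k + 2)) : PairOp := (embed m s).conjTranspose * ρ * embed m s

theorem outcomeProb_eq (ρ : Op (k + 2)) : outcomeProb m ρ s = (outerState m s ρ).trace.re := by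
  rw [outcomeProb, expect, ← embed_mul_conjTranspose, outerState, Matrix.mul_assoc,
    Matrix.trace_mul_comm]

theorem postState_eq (ρ : Op (k + 2)) :
    postState m ρ s = ((outcomeProb m ρ s : ℂ))⁻¹ • outerState m s ρ := by
  rw [postState, ← traceInner_embed m s (outerState m s ρ), outerState,
    ← embed_mul_conjTranspose]
  simp only [Matrix.mul_assoc]

theorem posSemidef_outerState {ρ : Op (k + 2)} (hρ : ρ.PosSemidef) :
    (outerState m s ρ).PosSemidef :=
  hρ.conjTranspose_mul_mul_same _

theorem sandwich_outerState (v : Fin 2 × Fin 2 → ℂ) (ρ : Op (k + 2)) :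
    sandwich v (outerState m s ρ) = sandwich ((embed m s).mulVec v) ρ := by
  rw [sandwich, sandwich, outerState, Matrix.star_mulVec, ← Matrix.dotProduct_mulVec,
    Matrix.mulVec_mulVec, Matrix.mulVec_mulVec]

theorem outerState_vecMulVec (v : (Fin (k + 2) → Fin 2) → ℂ) :
    outerState m s (Matrix.vecMulVec v (star v)) =
      Matrix.vecMulVec ((embed m s).conjTranspose.mulVec v)
        (star ((embed m s).conjTranspose.mulVec v)) := by
  rw [outerState, Matrix.mul_vecMulVec, Matrix.vecMulVec_mul, Matrix.star_mulVec,
    Matrix.conjTranspose_conjTranspose]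

theorem sum_outcomeProb {ρ : Op (k + 2)} (hρ : IsState ρ) : ∑ s, outcomeProb m ρ s = 1 := by
  simp_rw [outcomeProb, expect, ← Complex.re_sum, ← Matrix.trace_sum, ← Finset.sum_mul]
  rw [sum_measProj, one_mul, hρ.2, Complex.one_re]

theorem outcomeProb_nonneg {ρ : Op (k + 2)} (hρ : IsState ρ) : 0 ≤ outcomeProb m ρ s := by
  rw [outcomeProb_eq]
  exact (Complex.le_def.1 (posSemidef_outerState m s hρ.1).trace_nonneg).1

theorem sum_embed_mulVec (v : (Fin (k + 2) → Fin 2) → ℂ) :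
    ∑ s, (embed m s).mulVec ((embed m s).conjTranspose.mulVec v) = v := by
  simp_rw [Matrix.mulVec_mulVec, embed_mul_conjTranspose]
  rw [← Matrix.sum_mulVec, sum_measProj, Matrix.one_mulVec]

end Embed

/-! ### The cluster state as a matrix product -/

/-- The Hadamard matrix. -/
def hadamard : QubitOp :=
  Matrix.of fun a b => ((1 / Real.sqrt 2 : ℝ) : ℂ) * if a = 1 ∧ b = 1 then -1 else 1

theorem hadamard_conjTranspose_mul : hadamard.conjTranspose * hadamard = 1 := by
  have h := inv_sqrt_two_mul_self
  have h' : star ((1 / Real.sqrt 2 : ℝ) : ℂ) = ((1 / Real.sqrt 2 : ℝ) : ℂ) :=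
    Complex.conj_ofReal _
  ext a b
  simp only [Matrix.mul_apply, Matrix.conjTranspose_apply, hadamard, Matrix.of_apply, star_mul', h',
    Fin.sum_univ_two]
  generalize ((1 / Real.sqrt 2 : ℝ) : ℂ) = r at *
  fin_cases a <;> fin_cases b <;> simp <;> linear_combination 2 * h

/-- The matrix product `D₀ H D₁ H ⋯ H Dₖ`, where the `Dⱼ` are diagonal. -/
def chain : (k : ℕ) → (Fin (k + 1) → Fin 2 → ℂ) → QubitOp
  | 0, d => Matrix.diagonal (d 0)
  | k + 1, d => Matrix.diagonal (d 0) * (hadamard * chain k (Fin.tail d))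

/-- A new first qubit adds one edge and one `1/√2`, which together are an entry of the Hadamard
matrix. -/
theorem clusterVec_cons {n : ℕ} (a : Fin 2) (y : Fin (n + 1) → Fin 2) :
    clusterVec (n + 2) (Fin.cons a y : Fin (n + 2) → Fin 2) =
      hadamard a (y 0) * clusterVec (n + 1) y := by
  have h0 : ∏ j : Fin (n + 1), (if 0 = (j : ℕ) ∧ a = 1 ∧ y j = 1 then (-1 : ℂ) else 1) =
      if a = 1 ∧ y 0 = 1 then -1 else 1 := by
    rw [Finset.prod_eq_single 0]
    · simp
    · intro j _ hj
      have : 0 ≠ (j : ℕ) := fun h => hj (Fin.ext h.symm)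
      simp [this]
    · simp
  rw [clusterVec, clusterVec, Fin.prod_univ_succ, Fin.prod_univ_succ (n := n + 1)]
  simp only [Fin.prod_univ_succ (n := n + 1), Fin.cons_zero, Fin.cons_succ, Fin.val_succ,
    Fin.val_zero, zero_add, hadamard, Matrix.of_apply, Nat.add_right_cancel_iff]
  rw [← h0]
  simp [eq_comm (a := (0 : ℕ))]
  ring

/-- Transfer matrices: the sum over the interior bits is matrix multiplication. One `1/√2` is left
over because `k + 1` sites have only `k` edges. -/
theorem chain_apply (k : ℕ) (d : Fin (k + 1) → Fin 2 → ℂ) (a b : Fin 2) :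
    ∑ x : Fin (k + 1) → Fin 2, (if x 0 = a ∧ x (Fin.last k) = b then
        (∏ j, d j (x j)) * clusterVec (k + 1) x else 0) =
      ((1 / Real.sqrt 2 : ℝ) : ℂ) * chain k d a b := by
  have split : ∀ (n : ℕ) (f : (Fin (n + 1) → Fin 2) → ℂ),
      ∑ x, f x = ∑ c : Fin 2, ∑ y : Fin n → Fin 2, f (Fin.cons c y) := by
    intro n f
    rw [← Fintype.sum_prod_type', ← (Fin.consEquiv fun _ => Fin 2).sum_comp]
    rfl
  induction k generalizing a with
  | zero =>
    rw [split]
    simp only [Finset.univ_unique, Finset.sum_singleton, chain, Matrix.diagonal_apply]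
    have : ∀ x : Fin 1 → Fin 2, clusterVec 1 x = ((1 / Real.sqrt 2 : ℝ) : ℂ) := by
      intro x
      simp [clusterVec]
    simp only [this]
    fin_cases a <;> fin_cases b <;> simp [mul_comm]
  | succ k ih =>
    rw [split, Finset.sum_eq_single a]
    · simp only [clusterVec_cons, Fin.cons_zero, true_and, ← Fin.succ_last, Fin.cons_succ]
      rw [chain, Matrix.diagonal_mul, Matrix.mul_apply, Finset.mul_sum, Finset.mul_sum]
      have : ∀ c, ((1 / Real.sqrt 2 : ℝ) : ℂ) * (d 0 a * (hadamard a c * chain k (Fin.tail d) c b))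
          = ∑ y : Fin (k + 1) → Fin 2, if y 0 = c ∧ y (Fin.last k) = b then
            d 0 a * hadamard a c * ((∏ j, Fin.tail d j (y j)) * clusterVec (k + 1) y) else 0 := by
        intro c
        rw [← mul_assoc (d 0 a), mul_left_comm, ← ih, Finset.mul_sum]
        simp only [mul_ite, mul_zero]
      simp_rw [this]
      rw [Finset.sum_comm]
      refine Finset.sum_congr rfl fun y _ => ?_
      rw [Finset.sum_eq_single (y 0)]
      · simp only [true_and]
        rw [Fin.prod_univ_succ]
        simp only [Fin.cons_zero, Fin.cons_succ, Fin.tail]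
        split_ifs
        · ring
        · rfl
      · intro c _ hc
        simp [hc.symm]
      · simp
    · intro c _ hc
      simp [hc]
    · simp

theorem diagonal_conjTranspose_mul {e : Fin 2 → ℂ} (h : ∀ a, star (e a) * e a = 1) :
    (Matrix.diagonal e).conjTranspose * Matrix.diagonal e = 1 := by
  rw [Matrix.diagonal_conjTranspose, Matrix.diagonal_mul_diagonal, ← Matrix.diagonal_one]
  congr 1
  ext a
  exact h a

theorem chain_conjTranspose_mul (k : ℕ) (d : Fin (k + 1) → Fin 2 → ℂ)
    (h : ∀ j a, star (d j a) * d j a = 1) : (chain k d).conjTranspose * chain k d = 1 := by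
  induction k with
  | zero => exact diagonal_conjTranspose_mul (h 0)
  | succ k ih =>
    rw [chain, Matrix.conjTranspose_mul, Matrix.conjTranspose_mul]
    calc _ = (chain k (Fin.tail d)).conjTranspose * (hadamard.conjTranspose *
          ((Matrix.diagonal (d 0)).conjTranspose * Matrix.diagonal (d 0)) * hadamard) *
          chain k (Fin.tail d) := by simp only [Matrix.mul_assoc]
      _ = 1 := by
        rw [diagonal_conjTranspose_mul (h 0), Matrix.mul_one, hadamard_conjTranspose_mul,
          Matrix.mul_one, ih (Fin.tail d) fun j => h j.succ]

/-- A `Z` in one place of the chain makes it orthogonal to the original one. -/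
theorem trace_chain_conjTranspose_mul (k : ℕ) (d d' : Fin (k + 1) → Fin 2 → ℂ)
    (h : ∀ j a, star (d j a) * d j a = 1) (i : Fin (k + 1)) (hi : ∀ a, d' i a = bitSign a * d i a)
    (hd : ∀ j, j ≠ i → d' j = d j) : ((chain k d).conjTranspose * chain k d').trace = 0 := by
  have hz : ∀ e e' : Fin 2 → ℂ, (∀ a, star (e a) * e a = 1) → (∀ a, e' a = bitSign a * e a) →
      (Matrix.diagonal e).conjTranspose * Matrix.diagonal e' = pauliZ := by
    intro e e' he he'
    rw [Matrix.diagonal_conjTranspose, Matrix.diagonal_mul_diagonal]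
    have : ∀ a, star e a * e' a = bitSign a := fun a => by
      rw [he', Pi.star_apply, mul_left_comm, he, mul_one]
    simp_rw [this]
    ext a b
    fin_cases a <;> fin_cases b <;> simp [pauliZ, bitSign]
  have tz : pauliZ.trace = 0 := by simp [pauliZ, Matrix.trace]
  induction k with
  | zero =>
    have hi0 : i = 0 := Fin.eq_zero i
    subst hi0
    rw [chain, chain, hz _ _ (h 0) hi, tz]
  | succ k ih =>
    rw [chain, chain, Matrix.conjTranspose_mul, Matrix.conjTranspose_mul]
    have assoc : (chain k (Fin.tail d)).conjTranspose * hadamard.conjTranspose *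
        (Matrix.diagonal (d 0)).conjTranspose *
          (Matrix.diagonal (d' 0) * (hadamard * chain k (Fin.tail d'))) =
        (chain k (Fin.tail d)).conjTranspose * (hadamard.conjTranspose *
          ((Matrix.diagonal (d 0)).conjTranspose * Matrix.diagonal (d' 0)) * hadamard) *
          chain k (Fin.tail d') := by simp only [Matrix.mul_assoc]
    rw [assoc]
    -- If the `Z` sits at the head, everything around it is unitary and the trace is that of `Z`;
    -- otherwise the heads cancel and the error lies in the tail.
    induction i using Fin.cases with
    | zero =>
      have ht : Fin.tail d' = Fin.tail d := funext fun j => hd j.succ (Fin.succ_ne_zero j)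
      have hu := mul_eq_one_comm.1
        (chain_conjTranspose_mul k (Fin.tail d) fun j => h j.succ)
      have hh := mul_eq_one_comm.1 hadamard_conjTranspose_mul
      rw [ht, hz _ _ (h 0) hi, Matrix.mul_assoc, Matrix.trace_mul_comm, Matrix.mul_assoc, hu,
        Matrix.mul_one, Matrix.mul_assoc, Matrix.trace_mul_comm, Matrix.mul_assoc, hh,
        Matrix.mul_one, tz]
    | succ i =>
      rw [hd 0 (Fin.succ_ne_zero i).symm, diagonal_conjTranspose_mul (h 0), Matrix.mul_one,
        hadamard_conjTranspose_mul, Matrix.mul_one]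
      exact ih _ _ (fun j => h j.succ) i hi fun j hj => hd j.succ fun e => hj (Fin.succ_injective _ e)

/-! ### The outer pair after a measurement of a graph basis state -/

section Outer

variable {k : ℕ} (m : Fin k → MeasBasis) (s : Fin k → Fin 2)

/-- The diagonal factors of the chain that belongs to an outcome string and a graph basis state. -/
def siteFactor (w : Fin (k + 2) → Fin 2) (j : Fin (k + 2)) (a : Fin 2) : ℂ :=
  (if w j = 1 then (bitSign a : ℂ) else 1) *
    star (frame (fun _ => 1) (fun i => measPhase (m i) (s i)) (fun _ => 1) j a)

theorem star_siteFactor_mul (w : Fin (k + 2) → Fin 2) (j : Fin (k + 2)) (a : Fin 2) :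
    star (siteFactor m s w j a) * siteFactor m s w j a = 1 := by
  have h1 : star (if w j = 1 then (bitSign a : ℂ) else 1) *
      (if w j = 1 then (bitSign a : ℂ) else 1) = 1 := by
    split_ifs
    · rw [Complex.star_def, Complex.conj_ofReal, ← Complex.ofReal_mul, bitSign_mul_self,
        Complex.ofReal_one]
    · simp
  rw [siteFactor, star_mul', mul_mul_mul_comm, h1, one_mul, star_star, mul_comm]
  refine forall_frame (p := fun j => star (frame (fun _ => 1)
    (fun i => measPhase (m i) (s i)) (fun _ => 1) j a) * frame (fun _ => 1)
    (fun i => measPhase (m i) (s i)) (fun _ => 1) j a = 1) ?_ ?_ ?_ j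
  · simp
  · intro i
    rw [frame_inner, star_measPhase_mul]
  · simp

/-- The matrix of the state of the outer pair, up to normalization. -/
def outerUnitary (w : Fin (k + 2) → Fin 2) : QubitOp := chain (k + 1) (siteFactor m s w)

/-- The state of the outer pair after the outcome string `s` for the graph basis state `w`. -/
def outerVec (w : Fin (k + 2) → Fin 2) (p : Fin 2 × Fin 2) : ℂ :=
  ((1 / Real.sqrt 2 : ℝ) : ℂ) * outerUnitary m s w p.1 p.2

/-- Projecting an inner qubit onto an `X` or `Y` eigenvector only weights its bit by a phase, so the
sum over inner bits is a chain with unitary diagonal factors. The scalar depends on neither `s` nor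
`w`: all outcomes are equally likely. -/
theorem embed_conjTranspose_mulVec (w : Fin (k + 2) → Fin 2) :
    (embed m s).conjTranspose.mulVec (graphVec w) =
      (((1 / Real.sqrt 2 : ℝ) : ℂ) ^ k) • outerVec m s w := by
  ext p
  rw [Pi.smul_apply, outerVec, outerUnitary, ← chain_apply, smul_eq_mul, Finset.mul_sum,
    Matrix.mulVec, dotProduct]
  refine Finset.sum_congr rfl fun x _ => ?_
  rw [Matrix.conjTranspose_apply, embed_apply, graphVec, star_mul', star_mul', star_prod]
  simp only [siteFactor, Finset.prod_mul_distrib]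
  rw [prod_frame fun j => star (frame (fun _ => (1 : ℂ)) (fun i => measPhase (m i) (s i))
    (fun _ => 1) j (x j))]
  simp only [frame_zero, frame_inner, frame_last, measVec, star_mul', Finset.prod_mul_distrib,
    Finset.prod_const, Finset.card_univ, Fintype.card_fin, Complex.star_def, Complex.conj_ofReal,
    map_one, Pi.single_apply]
  by_cases h0 : x 0 = p.1 <;> by_cases h1 : x (Fin.last (k + 1)) = p.2 <;> simp [h0, h1]
  ring

theorem outerVec_dotProduct (w w' : Fin (k + 2) → Fin 2) :
    star (outerVec m s w) ⬝ᵥ outerVec m s w' =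
      ((outerUnitary m s w).conjTranspose * outerUnitary m s w').trace / 2 := by
  simp only [dotProduct, Pi.star_apply, outerVec, star_mul', Complex.star_def, Complex.conj_ofReal,
    Fintype.sum_prod_type, Matrix.trace, Matrix.diag_apply, Matrix.mul_apply,
    Matrix.conjTranspose_apply, Fin.sum_univ_two]
  have := inv_sqrt_two_mul_self
  generalize ((1 / Real.sqrt 2 : ℝ) : ℂ) = r at *
  generalize outerUnitary m s w = U
  generalize outerUnitary m s w' = U'
  linear_combination ((starRingEnd ℂ) (U 0 0) * U' 0 0 + (starRingEnd ℂ) (U 0 1) * U' 0 1 +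
    (starRingEnd ℂ) (U 1 0) * U' 1 0 + (starRingEnd ℂ) (U 1 1) * U' 1 1) * this

theorem outerUnitary_conjTranspose_mul (w : Fin (k + 2) → Fin 2) :
    (outerUnitary m s w).conjTranspose * outerUnitary m s w = 1 :=
  chain_conjTranspose_mul _ _ (star_siteFactor_mul m s w)

theorem outerVec_dotProduct_self (w : Fin (k + 2) → Fin 2) :
    star (outerVec m s w) ⬝ᵥ outerVec m s w = 1 := by
  rw [outerVec_dotProduct, outerUnitary_conjTranspose_mul]
  simp

theorem outerVec_zero_dotProduct_single (i : Fin (k + 2)) :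
    star (outerVec m s 0) ⬝ᵥ outerVec m s (Pi.single i 1) = 0 := by
  rw [outerVec_dotProduct, outerUnitary, outerUnitary,
    trace_chain_conjTranspose_mul _ _ _ (star_siteFactor_mul m s 0) i, zero_div]
  · intro a
    simp [siteFactor]
  · intro j hj
    ext a
    simp [siteFactor, hj]

/-- Bob's correction of the outcome string `s`. -/
def outerCorrection : Matrix.unitaryGroup (Fin 2) ℂ :=
  -- The entrywise conjugate: the overlap for `U` is taken with the vector whose coordinates are
  -- those of the conjugate of `U` over `√2`, and this vector has to be `outerVec m s 0`.
  ⟨(outerUnitary m s 0).conjTranspose.transpose, by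
    have h := outerUnitary_conjTranspose_mul m s 0
    have ht : ∀ M : QubitOp, star M.conjTranspose.transpose = M.transpose := by
      intro M
      ext a b
      simp [Matrix.star_apply]
    rw [Matrix.mem_unitaryGroup_iff, ht, ← Matrix.transpose_mul, mul_eq_one_comm.1 h,
      Matrix.transpose_one]⟩

/-- The vector is `(1 ⊗ U†)|φ⁺⟩` in coordinates. -/
theorem bellOverlap_eq_sandwich (τ : PairOp) (U : Matrix.unitaryGroup (Fin 2) ℂ) :
    bellOverlap τ U =
      sandwich (fun p => ((1 / Real.sqrt 2 : ℝ) : ℂ) * star ((U : QubitOp) p.1 p.2)) τ := by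
  rw [bellOverlap_eq, sandwich]
  have key : star (fun p : Fin 2 × Fin 2 =>
      ((1 / Real.sqrt 2 : ℝ) : ℂ) * star ((U : QubitOp) p.1 p.2)) ⬝ᵥ
      τ.mulVec (fun p => ((1 / Real.sqrt 2 : ℝ) : ℂ) * star ((U : QubitOp) p.1 p.2)) =
      (((1 / Real.sqrt 2 : ℝ) : ℂ) * ((1 / Real.sqrt 2 : ℝ) : ℂ)) *
      ∑ b, ∑ b', ∑ a, ∑ a', (U : QubitOp) a b * star ((U : QubitOp) a' b') *
        τ (a, b) (a', b') := by
    simp only [dotProduct, Matrix.mulVec, Pi.star_apply, star_mul', Complex.star_def,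
      Complex.conj_ofReal, Fintype.sum_prod_type, Fin.sum_univ_two, Complex.conj_conj]
    ring
  rw [key, inv_sqrt_two_mul_self]
  simp only [Complex.mul_re]
  norm_num
  ring

theorem bellOverlap_outerCorrection (τ : PairOp) :
    bellOverlap τ (outerCorrection m s) = sandwich (outerVec m s 0) τ := by
  rw [bellOverlap_eq_sandwich]
  congr 1
  ext p
  simp [outerVec, outerCorrection]

end Outer

/-! ### Convexity and orthogonality -/

section Inequalities

variable {ι : Type} [Fintype ι]

theorem sandwich_smul_left (a : ℂ) (v : ι → ℂ) (M : Matrix ι ι ℂ) :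
    sandwich (a • v) M = Complex.normSq a * sandwich v M := by
  have : star a * a = (Complex.normSq a : ℂ) := by
    rw [Complex.normSq_eq_conj_mul_self]
    rfl
  rw [sandwich, Matrix.mulVec_smul, dotProduct_smul, star_smul, smul_dotProduct, smul_eq_mul,
    smul_eq_mul, ← mul_assoc, mul_comm a, this, Complex.re_ofReal_mul, sandwich]

theorem sandwich_conjTranspose_mul_self (v : ι → ℂ) (B : Matrix ι ι ℂ) :
    sandwich v (B.conjTranspose * B) = ∑ i, ‖B.mulVec v i‖ ^ 2 := by
  rw [sandwich, ← Matrix.mulVec_mulVec, Matrix.dotProduct_mulVec, ← Matrix.star_mulVec, dotProduct,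
    Complex.re_sum]
  refine Finset.sum_congr rfl fun i _ => ?_
  rw [← Complex.normSq_eq_norm_sq, Pi.star_apply, ← Complex.ofReal_re (Complex.normSq _),
    Complex.normSq_eq_conj_mul_self]
  rfl

open scoped MatrixOrder in
-- With `M = B†B`, this is Cauchy–Schwarz in each coordinate of `B v`. It controls the coherences of
-- `ρ` between different outcomes.
theorem sandwich_sum_le {κ : Type} [Fintype κ] {M : Matrix ι ι ℂ} (hM : M.PosSemidef)
    (v : κ → ι → ℂ) :
    sandwich (∑ s, v s) M ≤ Fintype.card κ * ∑ s, sandwich (v s) M := by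
  classical
  obtain ⟨B, rfl⟩ := CStarAlgebra.nonneg_iff_eq_star_mul_self.1 hM.nonneg
  rw [Matrix.star_eq_conjTranspose]
  simp_rw [sandwich_conjTranspose_mul_self]
  rw [Finset.sum_comm, Finset.mul_sum]
  refine Finset.sum_le_sum fun i _ => ?_
  rw [Matrix.mulVec_sum, Finset.sum_apply]
  calc _ ≤ (∑ s, ‖B.mulVec (v s) i‖) ^ 2 := by gcongr; exact norm_sum_le _ _
    _ ≤ _ := sq_sum_le_card_mul_sum_sq

/-- Bessel's inequality for two vectors. -/
theorem normSq_add_normSq_le {u w v : ι → ℂ} (hu : star u ⬝ᵥ u = 1) (hw : star w ⬝ᵥ w = 1)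
    (huw : star u ⬝ᵥ w = 0) (hv : star v ⬝ᵥ v = 1) :
    Complex.normSq (star u ⬝ᵥ v) + Complex.normSq (star w ⬝ᵥ v) ≤ 1 := by
  have hwu : star w ⬝ᵥ u = 0 := by
    rw [Matrix.star_dotProduct, huw, star_zero]
  have hvu : star v ⬝ᵥ u = star (star u ⬝ᵥ v) := by rw [Matrix.star_dotProduct]
  have hvw : star v ⬝ᵥ w = star (star w ⬝ᵥ v) := by rw [Matrix.star_dotProduct]
  have key : star (v - (star u ⬝ᵥ v) • u - (star w ⬝ᵥ v) • w) ⬝ᵥ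
      (v - (star u ⬝ᵥ v) • u - (star w ⬝ᵥ v) • w) =
      ((1 - (Complex.normSq (star u ⬝ᵥ v) + Complex.normSq (star w ⬝ᵥ v)) : ℝ) : ℂ) := by
    simp only [star_sub, star_smul, sub_dotProduct, dotProduct_sub, smul_dotProduct,
      dotProduct_smul, hu, hw, huw, hwu, hv, hvu, hvw, smul_eq_mul]
    push_cast
    rw [Complex.normSq_eq_conj_mul_self, Complex.normSq_eq_conj_mul_self]
    simp only [Complex.star_def]
    ring
  have h0 := dotProduct_star_self_nonneg (v - (star u ⬝ᵥ v) • u - (star w ⬝ᵥ v) • w)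
  rw [key, Complex.zero_le_real] at h0
  linarith

end Inequalities

/-! ### Bounds on the localized fidelity -/

theorem normSq_inv_sqrt_two_pow (k : ℕ) :
    Complex.normSq (((1 / Real.sqrt 2 : ℝ) : ℂ) ^ k) = (1 / 2) ^ k := by
  rw [map_pow, Complex.normSq_ofReal, div_mul_div_comm, Real.mul_self_sqrt (by norm_num), one_mul]

section Localized

variable {k : ℕ} (m : Fin k → MeasBasis) (s : Fin k → Fin 2)

/-- Bob's corrections for the outcome string `s` and the Bell result `j`. -/
def corrections (s : Fin k → Fin 2) (j : Fin 4) : Matrix.unitaryGroup (Fin 2) ℂ :=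
  pauliUnitary j * outerCorrection m s

theorem fidelityWith_corrections (τ : PairOp) :
    fidelityWith τ (corrections m s) = (τ.trace.re + 2 * sandwich (outerVec m s 0) τ) / 3 := by
  rw [← bellOverlap_outerCorrection]
  exact fidelityWith_pauli_mul τ _

theorem outcomeProb_mul_fidelityWith {ρ : Op (k + 2)} (hρ : IsState ρ) :
    outcomeProb m ρ s * fidelityWith (postState m ρ s) (corrections m s) =
      (outcomeProb m ρ s + 2 * sandwich (outerVec m s 0) (outerState m s ρ)) / 3 := by
  by_cases hp : outcomeProb m ρ s = 0
  · have hN : outerState m s ρ = 0 := by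
      have hpos := posSemidef_outerState m s hρ.1
      refine hpos.trace_eq_zero_iff.1 (Complex.ext ?_ ?_)
      · rw [← outcomeProb_eq, hp, Complex.zero_re]
      · exact (Complex.le_def.1 hpos.trace_nonneg).2.symm
    rw [hp, hN]
    simp [sandwich]
  · rw [fidelityWith_corrections, postState_eq, ← Complex.ofReal_inv, sandwich_smul,
      Matrix.trace_smul, smul_eq_mul, Complex.re_ofReal_mul, ← outcomeProb_eq]
    field_simp

/-- The cluster vector is the sum over `s` of embedded outer vectors of weight `2^(-k)`; the
Cauchy–Schwarz factor `2^k`, the number of outcomes, cancels it exactly. -/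
theorem sandwich_clusterVec_le {ρ : Op (k + 2)} (hρ : IsState ρ) :
    sandwich (clusterVec (k + 2)) ρ ≤ ∑ s, sandwich (outerVec m s 0) (outerState m s ρ) := by
  have hC := sum_embed_mulVec m (clusterVec (k + 2))
  rw [← graphVec_zero] at hC
  simp_rw [embed_conjTranspose_mulVec] at hC
  have h := sandwich_sum_le hρ.1 fun s => (embed m s).mulVec
    ((((1 / Real.sqrt 2 : ℝ) : ℂ) ^ k) • outerVec m s 0)
  rw [hC, graphVec_zero] at h
  refine h.trans_eq ?_
  rw [Finset.mul_sum]
  refine Finset.sum_congr rfl fun s _ => ?_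
  rw [Matrix.mulVec_smul, sandwich_smul_left, normSq_inv_sqrt_two_pow, sandwich_outerState,
    ← mul_assoc]
  simp

theorem le_localizedFidelityWith {c : ℝ} {ρ : Op (k + 2)} (hρ : IsState ρ)
    (h : ∀ i, c ≤ expect (gen i) ρ) :
    1 - ((k + 2 : ℕ) : ℝ) / 3 * (1 - c) ≤ localizedFidelityWith m (corrections m) ρ := by
  have h1 := le_sandwich_clusterVec hρ h
  have h2 := sandwich_clusterVec_le m hρ
  simp_rw [localizedFidelityWith, outcomeProb_mul_fidelityWith m _ hρ]
  rw [← Finset.sum_div, Finset.sum_add_distrib, ← Finset.mul_sum, sum_outcomeProb m hρ]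
  linarith

theorem localizedFidelityWith_le {ρ : Op (k + 2)} (hρ : IsState ρ)
    (V : (Fin k → Fin 2) → Fin 4 → Matrix.unitaryGroup (Fin 2) ℂ) :
    localizedFidelityWith m V ρ ≤ localizedFidelity m ρ :=
  Finset.sum_le_sum fun s _ => mul_le_mul_of_nonneg_left
    (fidelityWith_le_teleportFidelity _ _) (outcomeProb_nonneg m s hρ)

/-! ### Measurements on the worst-case state -/

/-- The projector onto `outerVec`. -/
def outerProj (w : Fin (k + 2) → Fin 2) : PairOp :=
  Matrix.vecMulVec (outerVec m s w) (star (outerVec m s w))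

theorem trace_outerProj (w : Fin (k + 2) → Fin 2) : (outerProj m s w).trace = 1 := by
  rw [outerProj, Matrix.trace_vecMulVec, dotProduct_comm, outerVec_dotProduct_self]

theorem outerState_graphProj (w : Fin (k + 2) → Fin 2) :
    outerState m s (Matrix.vecMulVec (graphVec w) (star (graphVec w))) =
      (((1 / 2 : ℝ) ^ k : ℝ) : ℂ) • outerProj m s w := by
  rw [outerState_vecMulVec, embed_conjTranspose_mulVec, star_smul, Matrix.smul_vecMulVec,
    Matrix.vecMulVec_smul, smul_smul, outerProj, ← normSq_inv_sqrt_two_pow,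
    Complex.normSq_eq_conj_mul_self, mul_comm]
  rfl

/-- The state of the outer pair that every measurement of the worst-case state leaves. -/
def outerWcState (c : ℝ) : PairOp :=
  (wcWeight (k + 2) c : ℂ) • outerProj m s 0 +
    (((1 - wcWeight (k + 2) c) / (k + 2 : ℕ) : ℝ) : ℂ) • ∑ i, outerProj m s (Pi.single i 1)

theorem outerState_wcState (c : ℝ) :
    outerState m s (wcState (k + 2) c) = (((1 / 2 : ℝ) ^ k : ℝ) : ℂ) • outerWcState m s c := by
  have hadd : ∀ M N, outerState m s (M + N) = outerState m s M + outerState m s N := by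
    intro M N
    simp [outerState, Matrix.mul_add, Matrix.add_mul]
  have hsmul : ∀ (r : ℂ) M, outerState m s (r • M) = r • outerState m s M := by
    intro r M
    simp [outerState]
  have hsum : ∀ M : Fin (k + 2) → Op (k + 2),
      outerState m s (∑ i, M i) = ∑ i, outerState m s (M i) := by
    intro M
    simp [outerState, Matrix.mul_sum, Matrix.sum_mul]
  rw [wcState_eq, ← graphVec_zero, hadd, hsmul, hsmul, hsum]
  simp_rw [outerState_graphProj]
  rw [outerWcState, smul_add, ← Finset.smul_sum, smul_comm, smul_comm (((1 - _) / _ : ℝ) : ℂ)]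

theorem trace_outerWcState (c : ℝ) : (outerWcState m s c).trace = 1 := by
  rw [outerWcState, Matrix.trace_add, Matrix.trace_smul, Matrix.trace_smul, Matrix.trace_sum]
  simp only [trace_outerProj, smul_eq_mul, Finset.sum_const, Finset.card_univ, Fintype.card_fin,
    nsmul_eq_mul, mul_one]
  norm_cast
  field_simp
  ring

theorem outcomeProb_wcState (c : ℝ) : outcomeProb m (wcState (k + 2) c) s = (1 / 2) ^ k := by
  rw [outcomeProb_eq, outerState_wcState, Matrix.trace_smul, trace_outerWcState, smul_eq_mul,
    mul_one, Complex.ofReal_re]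

theorem postState_wcState (c : ℝ) : postState m (wcState (k + 2) c) s = outerWcState m s c := by
  have h : (((1 / 2 : ℝ) ^ k : ℝ) : ℂ) ≠ 0 := Complex.ofReal_ne_zero.2 (by positivity)
  rw [postState_eq, outerState_wcState, outcomeProb_wcState, inv_smul_smul₀ h]

theorem sandwich_outerWcState (v : Fin 2 × Fin 2 → ℂ) (c : ℝ) :
    sandwich v (outerWcState m s c) =
      wcWeight (k + 2) c * Complex.normSq (star (outerVec m s 0) ⬝ᵥ v) +
      (1 - wcWeight (k + 2) c) / (k + 2 : ℕ) *
        ∑ i, Complex.normSq (star (outerVec m s (Pi.single i 1)) ⬝ᵥ v) := by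
  rw [outerWcState, sandwich_add, sandwich_smul, sandwich_smul, sandwich_sum]
  simp_rw [outerProj, sandwich_vecMulVec]

theorem sandwich_outerVec_outerWcState (c : ℝ) :
    sandwich (outerVec m s 0) (outerWcState m s c) = wcWeight (k + 2) c := by
  have h : ∀ i, star (outerVec m s (Pi.single i 1)) ⬝ᵥ outerVec m s 0 = 0 := by
    intro i
    rw [Matrix.star_dotProduct, outerVec_zero_dotProduct_single, star_zero]
  rw [sandwich_outerWcState, outerVec_dotProduct_self]
  simp [h]

theorem fidelityWith_postState_wcState (c : ℝ) :
    fidelityWith (postState m (wcState (k + 2) c) s) (corrections m s) =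
      1 - ((k + 2 : ℕ) : ℝ) / 3 * (1 - c) := by
  rw [postState_wcState, fidelityWith_corrections, trace_outerWcState,
    sandwich_outerVec_outerWcState, wcWeight, Complex.one_re]
  ring

/-- No maximally entangled state has a larger overlap with the worst-case state than the one that
belongs to the ideal cluster state, as long as the weight of the latter is at least `1 / 2`. -/
theorem sandwich_outerWcState_le {c : ℝ} (h0 : 1 / 2 ≤ wcWeight (k + 2) c)
    (h1 : wcWeight (k + 2) c ≤ 1) {v : Fin 2 × Fin 2 → ℂ} (hv : star v ⬝ᵥ v = 1) :
    sandwich v (outerWcState m s c) ≤ wcWeight (k + 2) c := by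
  rw [sandwich_outerWcState]
  -- Bessel is applied to the ideal vector and one error at a time, because the error vectors need
  -- not be orthogonal to each other: for `k ≥ 2` there are too many of them for that in dimension
  -- four.
  have hB : ∀ i, Complex.normSq (star (outerVec m s (Pi.single i 1)) ⬝ᵥ v) ≤
      1 - Complex.normSq (star (outerVec m s 0) ⬝ᵥ v) := by
    intro i
    have := normSq_add_normSq_le (outerVec_dotProduct_self m s 0)
      (outerVec_dotProduct_self m s (Pi.single i 1)) (outerVec_zero_dotProduct_single m s i) hv
    linarith
  have ht : Complex.normSq (star (outerVec m s 0) ⬝ᵥ v) ≤ 1 := by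
    have := (Complex.normSq_nonneg _).trans (hB 0)
    linarith
  generalize Complex.normSq (star (outerVec m s 0) ⬝ᵥ v) = t at *
  have hs : ∑ i, Complex.normSq (star (outerVec m s (Pi.single i 1)) ⬝ᵥ v) ≤
      (k + 2 : ℕ) * (1 - t) := by
    simpa using Finset.sum_le_card_nsmul Finset.univ
      (fun i => Complex.normSq (star (outerVec m s (Pi.single i 1)) ⬝ᵥ v)) _ fun i _ => hB i
  have hn : (0 : ℝ) < (k + 2 : ℕ) := by positivity
  have hle := mul_le_mul_of_nonneg_left hs
    (div_nonneg (sub_nonneg.2 h1) hn.le : 0 ≤ (1 - wcWeight (k + 2) c) / (k + 2 : ℕ))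
  rw [← mul_assoc, div_mul_cancel₀ _ hn.ne'] at hle
  -- What remains is `λt + (1 - λ)(1 - t) ≤ λ`, that is `(2λ - 1)(1 - t) ≥ 0`.
  nlinarith

theorem fullyEntangledFraction_outerWcState {c : ℝ} (h0 : 1 / 2 ≤ wcWeight (k + 2) c)
    (h1 : wcWeight (k + 2) c ≤ 1) :
    fullyEntangledFraction (outerWcState m s c) = wcWeight (k + 2) c := by
  refine le_antisymm (ciSup_le fun U => ?_) ?_
  · rw [bellOverlap_eq_sandwich]
    refine sandwich_outerWcState_le m s h0 h1 ?_
    have hU : (U : QubitOp) * star (U : QubitOp) = 1 := Matrix.mem_unitaryGroup_iff.1 U.2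
    have htr := congrArg Matrix.trace hU
    simp only [Matrix.trace, Matrix.diag_apply, Matrix.mul_apply, Matrix.star_apply,
      Matrix.one_apply_eq, Fin.sum_univ_two] at htr
    have hr := inv_sqrt_two_mul_self
    simp only [dotProduct, Pi.star_apply, star_mul', Fintype.sum_prod_type, Fin.sum_univ_two,
      Complex.star_def, Complex.conj_ofReal, Complex.conj_conj] at htr ⊢
    generalize ((1 / Real.sqrt 2 : ℝ) : ℂ) = r at *
    linear_combination r * r * htr + 2 * hr
  · rw [← sandwich_outerVec_outerWcState m s c, ← bellOverlap_outerCorrection]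
    exact bellOverlap_le _ _

theorem teleportFidelity_postState_wcState {c : ℝ} (h0 : 1 / 2 ≤ wcWeight (k + 2) c)
    (h1 : wcWeight (k + 2) c ≤ 1) :
    teleportFidelity (postState m (wcState (k + 2) c) s) =
      1 - ((k + 2 : ℕ) : ℝ) / 3 * (1 - c) := by
  rw [postState_wcState, teleportFidelity_eq, trace_outerWcState,
    fullyEntangledFraction_outerWcState m s h0 h1, wcWeight, Complex.one_re]
  ring

end Localized

end LinearCluster

end

theorem mainTheorem3 :
    (∀ τ : LinearCluster.PairOp, LinearCluster.IsState τ →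
      LinearCluster.teleportFidelity τ =
        (1 + 2 * LinearCluster.fullyEntangledFraction τ) / 3) ∧
    ∀ (k : ℕ) (m : Fin k → LinearCluster.MeasBasis),
      (∀ (c : ℝ) (ρ : LinearCluster.Op (k + 2)), LinearCluster.IsState ρ →
        (∀ i, c ≤ LinearCluster.expect (LinearCluster.gen i) ρ) →
        1 - ((k + 2 : ℕ) : ℝ) / 3 * (1 - c) ≤ LinearCluster.localizedFidelity m ρ) ∧
      (∃ V : (Fin k → Fin 2) → Fin 4 → Matrix.unitaryGroup (Fin 2) ℂ,
        (∀ (c : ℝ) (ρ : LinearCluster.Op (k + 2)), LinearCluster.IsState ρ →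
          (∀ i, c ≤ LinearCluster.expect (LinearCluster.gen i) ρ) →
          1 - ((k + 2 : ℕ) : ℝ) / 3 * (1 - c) ≤ LinearCluster.localizedFidelityWith m V ρ) ∧
        (∀ c : ℝ, c ≤ 1 → ((k + 2 : ℕ) : ℝ) * (1 - c) ≤ 2 → ∀ s : Fin k → Fin 2,
          LinearCluster.fidelityWith
            (LinearCluster.postState m (LinearCluster.wcState (k + 2) c) s) (V s) =
              1 - ((k + 2 : ℕ) : ℝ) / 3 * (1 - c))) ∧
      (∀ c : ℝ, c ≤ 1 → ((k + 2 : ℕ) : ℝ) * (1 - c) ≤ 2 →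
        LinearCluster.IsState (LinearCluster.wcState (k + 2) c) ∧
        (∀ i, LinearCluster.expect (LinearCluster.gen i) (LinearCluster.wcState (k + 2) c) = c) ∧
        ∀ s : Fin k → Fin 2,
          0 < LinearCluster.outcomeProb m (LinearCluster.wcState (k + 2) c) s ∧
          1 - ((k + 2 : ℕ) : ℝ) / 3 * (1 - c) ≤ LinearCluster.teleportFidelity
            (LinearCluster.postState m (LinearCluster.wcState (k + 2) c) s)) ∧
      (∀ c : ℝ, c ≤ 1 → ((k + 2 : ℕ) : ℝ) * (1 - c) ≤ 1 →
        (∀ s : Fin k → Fin 2, LinearCluster.teleportFidelity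
          (LinearCluster.postState m (LinearCluster.wcState (k + 2) c) s) =
            1 - ((k + 2 : ℕ) : ℝ) / 3 * (1 - c)) ∧
        LinearCluster.localizedFidelity m (LinearCluster.wcState (k + 2) c) =
          1 - ((k + 2 : ℕ) : ℝ) / 3 * (1 - c)) := by
  refine ⟨fun τ hτ => ?_, fun k m => ?_⟩
  · rw [LinearCluster.teleportFidelity_eq, hτ.2, Complex.one_re]
  have weight_le : ∀ c : ℝ, c ≤ 1 → LinearCluster.wcWeight (k + 2) c ≤ 1 := by
    intro c hc
    have : 0 ≤ ((k + 2 : ℕ) : ℝ) * (1 - c) := mul_nonneg (Nat.cast_nonneg _) (by linarith)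
    rw [LinearCluster.wcWeight]
    linarith
  have isState : ∀ c : ℝ, c ≤ 1 → ((k + 2 : ℕ) : ℝ) * (1 - c) ≤ 2 →
      LinearCluster.IsState (LinearCluster.wcState (k + 2) c) := by
    intro c hc h
    refine LinearCluster.isState_wcState (by omega) ?_ (weight_le c hc)
    rw [LinearCluster.wcWeight]
    linarith
  refine ⟨fun c ρ hρ h => ?_, ⟨LinearCluster.corrections m, fun c ρ hρ h => ?_,
    fun c _ _ s => ?_⟩, fun c hc h => ⟨isState c hc h, ?_, fun s => ⟨?_, ?_⟩⟩, fun c hc h => ?_⟩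
  · exact (LinearCluster.le_localizedFidelityWith m hρ h).trans
      (LinearCluster.localizedFidelityWith_le m hρ _)
  · exact LinearCluster.le_localizedFidelityWith m hρ h
  · exact LinearCluster.fidelityWith_postState_wcState m s c
  · exact LinearCluster.expect_gen_wcState c
  · rw [LinearCluster.outcomeProb_wcState]
    positivity
  · rw [← LinearCluster.fidelityWith_postState_wcState m s c]
    exact LinearCluster.fidelityWith_le_teleportFidelity _ _
  -- The classical threshold `2/3` corresponds to `λ = 1/2`, where the ideal vector stops being
  -- guaranteed to be the best one.
  · have half_le : 1 / 2 ≤ LinearCluster.wcWeight (k + 2) c := by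
      rw [LinearCluster.wcWeight]
      linarith
    have hF := fun s =>
      LinearCluster.teleportFidelity_postState_wcState m s half_le (weight_le c hc)
    refine ⟨hF, ?_⟩
    simp_rw [LinearCluster.localizedFidelity, hF]
    rw [← Finset.sum_mul, LinearCluster.sum_outcomeProb m (isState c hc (by linarith)), one_mul]
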